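/- Let $\Sigma=\tilde\Sigma/G$ be a complete, connected, oriented hyperbolic surface of finite area with at least one cusp, possibly with boundary consisting of closed geodesics; here $\tilde\Sigma\subseteq\mathbb H$ is the universal cover (a closed convex subset with non-empty interior, equal to $\mathbb H$ if $\Sigma$ has no boundary) and $G\cong\pi_1(\Sigma)$ is the deck group, acting freely and properly discontinuously as a subgroup of $\mathrm{PSL}(2,\mathbb R)$. Let $\partial^\infty\tilde\Sigma\subseteq\mathbb R\cup\{\infty\}$ be the set of accumulation points of $\tilde\Sigma$ at infinity, let $\partial_2^\infty\tilde\Sigma$ be the space of its two-point subsets with the Vietoris topology, and let $\mathrm{GC}(\Sigma)$ be the space of $G$-invariant Borel measures on $\partial_2^\infty\tilde\Sigma$ that are finite on compact sets, with the weak-$*$ topology (tested against compactly supported continuous functions). For $P\in\partial_2^\infty\tilde\Sigma$ put $\eta_P=\sum_{g\,\mathrm{Stab}(P)\in G/\mathrm{Stab}(P)}\delta_{gP}$. For hyperbolic $g\in G$ with fixed points $g^{\pm\infty}$ put $\eta_g=\sum_{h\langle g\rangle\in G/\langle g\rangle}\delta_{h\{g^{\infty},g^{-\infty}\}}$; for $g$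 parabolic or $g=1$ put $\eta_g=0$. (1) Let $\alpha,\beta\in G$ be parabolic elements whose fixed points $\alpha^\infty,\beta^\infty$ are distinct. Then $\alpha^n\beta^n$ is hyperbolic for every $n\ge 2$, the measures $\eta_{\alpha^n\beta^n}$ ($n\ge0$) and $\eta_{\{\alpha^\infty,\beta^\infty\}}$ belong to $\mathrm{GC}(\Sigma)$, and $$\eta_{\alpha^n\beta^n}\longrightarrow 2\,\eta_{\{\alpha^\infty,\beta^\infty\}}\quad\text{in }\mathrm{GC}(\Sigma)\text{ as }n\to\infty .$$ (2) Consequently the intersection number of closed geodesics does not extend continuously to $\mathrm{GC}(\Sigma)$: there is no continuous function $i:\mathrm{GC}(\Sigma)\times\mathrm{GC}(\Sigma)\to\mathbb R$ (in particular, no continuous bilinear one) such that for all hyperbolic $g,h\in G$ the value $i(\eta_g,\eta_h)$ is the geometric intersection number of the closed geodesics of $\Sigma$ represented by $g$ and $h$, i.e. the number of double cosets $\langle g\rangle k\langle h\rangle\subseteq G$ for which the axes of $g$ and of $khk^{-1}$ meet in exactly one point. -/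

import Mathlib

open Set Filter Topology MeasureTheory UpperHalfPlane
open scoped MatrixGroups OnePoint CompactlySupported

noncomputable section

namespace CuspedSurface

/-! ## `PSL(2, ℝ)` and its actions on the hyperbolic plane `ℍ` and on the boundary `ℝ ∪ {∞}` -/

/-- The group of orientation preserving isometries of the hyperbolic plane. -/
abbrev PSL2R : Type := Matrix.ProjectiveSpecialLinearGroup (Fin 2) ℝ

lemma smul_upperHalfPlane_of_mem_center {A : SL(2, ℝ)} (hA : A ∈ Subgroup.center SL(2, ℝ))
    (z : ℍ) : A • z = z := by
  obtain ⟨r, hr, hrA⟩ := Matrix.SpecialLinearGroup.mem_center_iff.mp hA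
  have hr0 : (r : ℂ) ≠ 0 := by
    intro h
    have : r = 0 := by exact_mod_cast h
    simp [this] at hr
  ext1
  rw [UpperHalfPlane.coe_specialLinearGroup_apply]
  simp [← hrA, hr0]

lemma smul_onePoint_of_mem_center {A : SL(2, ℝ)} (hA : A ∈ Subgroup.center SL(2, ℝ))
    (p : OnePoint ℝ) : Matrix.SpecialLinearGroup.toGL A • p = p := by
  obtain ⟨r, hr, hrA⟩ := Matrix.SpecialLinearGroup.mem_center_iff.mp hA
  have hr0 : r ≠ 0 := by
    intro h
    simp [h] at hr
  cases p with
  | infty => simp [OnePoint.smul_infty_eq_ite, ← hrA]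
  | coe x => simp [OnePoint.smul_some_eq_ite, ← hrA, hr0]

/-- `PSL(2, ℝ)` as a group of transformations of `ℍ`. -/
def toPermUpperHalfPlane : PSL2R →* Equiv.Perm ℍ :=
  QuotientGroup.lift _ (MulAction.toPermHom SL(2, ℝ) ℍ) fun _ hA ↦
    Equiv.ext (smul_upperHalfPlane_of_mem_center hA)

/-- `PSL(2, ℝ)` as a group of transformations of the circle `ℝ ∪ {∞}`. -/
def toPermOnePoint : PSL2R →* Equiv.Perm (OnePoint ℝ) :=
  QuotientGroup.lift _
    ((MulAction.toPermHom (GL (Fin 2) ℝ) (OnePoint ℝ)).comp Matrix.SpecialLinearGroup.toGL)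
    fun _ hA ↦ Equiv.ext (smul_onePoint_of_mem_center hA)

/-- The action of `PSL(2, ℝ)` on `ℍ` by Möbius transformations. -/
instance instActionUpperHalfPlane : MulAction PSL2R ℍ :=
  MulAction.compHom ℍ toPermUpperHalfPlane

/-- The action of `PSL(2, ℝ)` on the boundary circle `ℝ ∪ {∞}` by Möbius transformations. -/
instance instActionOnePoint : MulAction PSL2R (OnePoint ℝ) :=
  MulAction.compHom (OnePoint ℝ) toPermOnePoint

lemma mk_smul_upperHalfPlane (A : SL(2, ℝ)) (z : ℍ) : (A : PSL2R) • z = A • z := rfl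

lemma mk_smul_onePoint (A : SL(2, ℝ)) (p : OnePoint ℝ) :
    (A : PSL2R) • p = Matrix.SpecialLinearGroup.toGL A • p := rfl

/-- `g` is a parabolic element of `PSL(2, ℝ)`. -/
def IsParabolic (g : PSL2R) : Prop :=
  ∃ A : SL(2, ℝ), (A : PSL2R) = g ∧ (A : Matrix (Fin 2) (Fin 2) ℝ).IsParabolic

/-- `g` is a hyperbolic element of `PSL(2, ℝ)`. -/
def IsHyperbolic (g : PSL2R) : Prop :=
  ∃ A : SL(2, ℝ), (A : PSL2R) = g ∧ (A : Matrix (Fin 2) (Fin 2) ℝ).IsHyperbolic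

/-! ## Geodesic lines and the boundary at infinity -/

/-- The geodesic line of `ℍ` whose set of endpoints is `P` (empty if `P` does not consist of two
points): the isometries that carry `0, ∞` to the endpoints carry the imaginary axis, which is
the geodesic line with endpoints `0, ∞`, to this line, and the image of `I` runs through all of
it. -/
def geodesicLine (P : Set (OnePoint ℝ)) : Set ℍ :=
  {z | ∃ A : PSL2R, {A • ((0 : ℝ) : OnePoint ℝ), A • (∞ : OnePoint ℝ)} = P ∧ A • I = z}

/-- The set of fixed points on the circle at infinity; for hyperbolic `g` these are the two
limit points `g^{±∞}` of `⟨g⟩`. -/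
def fixedPointSet (g : PSL2R) : Set (OnePoint ℝ) := {p | g • p = p}

/-- The axis of a hyperbolic element. -/
def axis (g : PSL2R) : Set ℍ := geodesicLine (fixedPointSet g)

/-- The embedding of `ℍ` into the Riemann sphere. -/
def toSphere (z : ℍ) : OnePoint ℂ := ((z : ℂ) : OnePoint ℂ)

/-- The embedding of the circle at infinity `ℝ ∪ {∞}` into the Riemann sphere. -/
def boundaryToSphere (p : OnePoint ℝ) : OnePoint ℂ := OnePoint.map Complex.ofRealHom p

/-- The accumulation points of `C ⊆ ℍ` in the circle at infinity. -/
def boundaryAtInfinity (C : Set ℍ) : Set (OnePoint ℝ) :=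
  {p | boundaryToSphere p ∈ closure (toSphere '' C)}

lemma continuous_smul_sphere (g : GL (Fin 2) ℂ) :
    Continuous fun x : OnePoint ℂ ↦ g • x := by
  have hdet : g 0 0 * g 1 1 - g 0 1 * g 1 0 ≠ 0 := by
    have := g.det_ne_zero
    rwa [Matrix.det_fin_two] at this
  have hcc : coclosedCompact ℂ = Bornology.cobounded ℂ := by
    rw [coclosedCompact_eq_cocompact, Metric.cobounded_eq_cocompact]
  have hcoe : Tendsto ((↑) : ℂ → OnePoint ℂ) (Bornology.cobounded ℂ) (𝓝 ∞) := by
    rw [← hcc]; exact OnePoint.tendsto_coe_infty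
  have haff : ∀ a b : ℂ, a ≠ 0 →
      Tendsto (fun x : ℂ ↦ a * x + b) (Bornology.cobounded ℂ) (Bornology.cobounded ℂ) := by
    intro a b ha
    have h1 : Tendsto (fun x : ℂ ↦ ‖a‖ * ‖x‖ + -‖b‖) (Bornology.cobounded ℂ) atTop :=
      tendsto_atTop_add_const_right _ _
        (tendsto_norm_cobounded_atTop.const_mul_atTop (norm_pos_iff.mpr ha))
    refine tendsto_norm_atTop_iff_cobounded.mp (tendsto_atTop_mono (fun x ↦ ?_) h1)
    have h2 := norm_sub_norm_le (a * x) (-b)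
    rw [norm_neg, sub_neg_eq_add, norm_mul] at h2
    linarith
  refine continuous_iff_continuousAt.mpr fun x ↦ ?_
  cases x with
  | infty =>
    rw [OnePoint.continuousAt_infty', hcc, OnePoint.smul_infty_eq_ite]
    by_cases hc : g 1 0 = 0
    · have hd : g 1 1 ≠ 0 := by rintro hd; simp [hc, hd] at hdet
      have ha : g 0 0 ≠ 0 := by rintro ha; simp [hc, ha] at hdet
      rw [if_pos hc]
      refine (hcoe.comp (haff (g 0 0 / g 1 1) (g 0 1 / g 1 1) (div_ne_zero ha hd))).congr
        fun x ↦ ?_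
      simp only [Function.comp_apply, OnePoint.smul_some_eq_ite, hc, zero_mul, zero_add, hd,
        if_false]
      congr 1
      field_simp
    · rw [if_neg hc]
      have h0 : ∀ᶠ x : ℂ in Bornology.cobounded ℂ, g 1 0 * x + g 1 1 ≠ 0 :=
        (haff _ (g 1 1) hc).eventually (Bornology.eventually_ne_cobounded 0)
      have hlim : Tendsto (fun x : ℂ ↦ g 0 0 / g 1 0 +
          (g 0 1 - g 0 0 * g 1 1 / g 1 0) * (g 1 0 * x + g 1 1)⁻¹) (Bornology.cobounded ℂ)
          (𝓝 (g 0 0 / g 1 0 + (g 0 1 - g 0 0 * g 1 1 / g 1 0) * 0)) :=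
        ((tendsto_inv₀_cobounded.comp (haff _ (g 1 1) hc)).const_mul _).const_add _
      rw [mul_zero, add_zero] at hlim
      refine ((OnePoint.continuous_coe.tendsto _).comp hlim).congr' ?_
      filter_upwards [h0] with x hx
      simp only [Function.comp_apply, OnePoint.smul_some_eq_ite, hx, if_false]
      congr 1
      field_simp
      ring
  | coe x =>
    rw [OnePoint.continuousAt_coe]
    have hcont : ∀ i, ContinuousAt (fun y : ℂ ↦ g i 0 * y + g i 1) x := fun i ↦ by fun_prop
    by_cases hx : g 1 0 * x + g 1 1 = 0
    · have hN : g 0 0 * x + g 0 1 ≠ 0 := by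
        intro hN
        by_cases hc : g 1 0 = 0
        · have hd : g 1 1 = 0 := by simpa [hc] using hx
          simp [hc, hd] at hdet
        · apply hdet
          have h2 : g 1 0 * (g 0 0 * g 1 1 - g 0 1 * g 1 0) = 0 := by
            linear_combination g 1 0 * g 0 0 * hx - g 1 0 * g 1 0 * hN
          exact (mul_eq_zero.mp h2).resolve_left hc
      have hc : g 1 0 ≠ 0 := by
        intro hc
        have hd : g 1 1 = 0 := by simpa [hc] using hx
        simp [hc, hd] at hdet
      rw [continuousAt_iff_punctured_nhds]
      simp only [Function.comp_apply, OnePoint.smul_some_eq_ite, hx, if_true]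
      have hD : ∀ᶠ y in 𝓝[≠] x, g 1 0 * y + g 1 1 ≠ 0 := by
        filter_upwards [self_mem_nhdsWithin] with y hy h
        apply hy
        have : g 1 0 * (y - x) = 0 := by linear_combination h - hx
        exact sub_eq_zero.mp ((mul_eq_zero.mp this).resolve_left hc)
      have hlim : Tendsto (fun y ↦ (g 1 0 * y + g 1 1) / (g 0 0 * y + g 0 1)) (𝓝[≠] x)
          (𝓝[≠] 0) := by
        refine tendsto_nhdsWithin_iff.mpr ⟨?_, ?_⟩
        · have := ((hcont 1).div (hcont 0) hN).tendsto
          simp only [hx, zero_div, Pi.div_apply] at this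
          exact this.mono_left nhdsWithin_le_nhds
        · filter_upwards [hD, ((hcont 0).eventually_ne hN).filter_mono nhdsWithin_le_nhds]
            with y h1 h2
          exact div_ne_zero h1 h2
      refine (hcoe.comp (tendsto_inv₀_nhdsNE_zero.comp hlim)).congr' ?_
      filter_upwards [hD] with y hy
      simp only [Function.comp_apply, OnePoint.smul_some_eq_ite, hy, if_false, inv_div]
    · have hev : ∀ᶠ y in 𝓝 x, g 1 0 * y + g 1 1 ≠ 0 := (hcont 1).eventually_ne hx
      have h1 : ContinuousAt (fun y : ℂ ↦
          (((g 0 0 * y + g 0 1) / (g 1 0 * y + g 1 1) : ℂ) : OnePoint ℂ)) x :=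
        OnePoint.continuous_coe.continuousAt.comp ((hcont 0).div (hcont 1) hx)
      refine h1.congr ?_
      filter_upwards [hev] with y hy
      simp [OnePoint.smul_some_eq_ite, hy]

lemma smul_mem_boundaryAtInfinity {C : Set ℍ} {g : PSL2R} (hg : ∀ z ∈ C, g • z ∈ C)
    {p : OnePoint ℝ} (hp : p ∈ boundaryAtInfinity C) : g • p ∈ boundaryAtInfinity C := by
  obtain ⟨A, rfl⟩ := QuotientGroup.mk_surjective g
  set B : GL (Fin 2) ℂ := (Matrix.SpecialLinearGroup.toGL A).map Complex.ofRealHom with hB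
  have h1 : boundaryToSphere ((A : PSL2R) • p) = B • boundaryToSphere p := by
    rw [mk_smul_onePoint]
    exact OnePoint.map_smul Complex.ofRealHom _ p
  have h2 : ∀ z : ℍ, B • toSphere z = toSphere ((A : PSL2R) • z) := by
    intro z
    have hden : (A 1 0 : ℂ) * z + A 1 1 ≠ 0 :=
      UpperHalfPlane.denom_ne_zero (Matrix.SpecialLinearGroup.toGL A) z
    rw [mk_smul_upperHalfPlane, toSphere, toSphere, OnePoint.smul_some_eq_ite,
      UpperHalfPlane.coe_specialLinearGroup_apply]
    simp [hB, hden]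
  rw [boundaryAtInfinity, mem_ofPred_eq] at hp ⊢
  rw [h1]
  refine map_mem_closure (continuous_smul_sphere B) hp ?_
  rintro _ ⟨z, hz, rfl⟩
  exact ⟨_, hg z hz, (h2 z).symm⟩

/-! ## Cusped hyperbolic surfaces of finite area -/

end CuspedSurface

open CuspedSurface in
/-- A complete, connected, oriented hyperbolic surface `Σ` of finite area, possibly with boundary
consisting of closed geodesics, with at least one cusp. It is given as `Σ = cover / group`, where
`cover ⊆ ℍ` is the universal cover of `Σ` and `group ≤ PSL(2, ℝ)` is the group of
deck transformations (isomorphic to the fundamental group). If `Σ` has no boundary, then `cover`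
is all of `ℍ`. -/
structure CuspedSurface where
  /-- the deck transformation group -/
  group : Subgroup PSL2R
  /-- the universal cover -/
  cover : Set ℍ
  properlyDiscontinuous : ProperlyDiscontinuousSMul group ℍ
  free : ∀ g ∈ group, ∀ z : ℍ, g • z = z → g = 1
  cover_invariant : ∀ g ∈ group, ∀ z ∈ cover, g • z ∈ cover
  cover_closed : IsClosed cover
  cover_interior : (interior cover).Nonempty
  /-- `cover` is geodesically convex -/
  cover_convex : ∀ x ∈ cover, ∀ y ∈ cover, ∀ z, dist x z + dist z y = dist x y → z ∈ cover
  /-- the boundary of the surface consists of closed geodesics -/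
  cover_frontier : ∀ z ∈ frontier cover, ∃ g ∈ group,
    IsHyperbolic g ∧ z ∈ axis g ∧ axis g ⊆ frontier cover
  /-- the area of `cover / group` is finite -/
  finite_area : ∃ F : Set ℍ, IsFundamentalDomain group F volume ∧ volume (F ∩ cover) < ⊤
  has_cusp : ∃ g ∈ group, IsParabolic g

namespace CuspedSurface

variable (S : CuspedSurface)

/-- The boundary at infinity `∂^∞ Σ~` of the universal cover. -/
def boundary : Set (OnePoint ℝ) := boundaryAtInfinity S.cover

/-- The space `∂₂^∞ Σ~` of two-point subsets of the boundary at infinity. -/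
def Pairs : Type := {P : Set (OnePoint ℝ) // P ⊆ S.boundary ∧ P.ncard = 2}

/-- A two-point subset of the boundary at infinity as a point of `∂₂^∞ Σ~`. -/
def toPairs (P : Set (OnePoint ℝ)) (hP : P ⊆ S.boundary ∧ P.ncard = 2) : S.Pairs := ⟨P, hP⟩

/-- `∂₂^∞ Σ~` carries the (subspace topology of the) Vietoris topology. -/
instance instTopologicalSpacePairs : TopologicalSpace S.Pairs :=
  TopologicalSpace.induced Subtype.val (TopologicalSpace.vietoris (OnePoint ℝ))

instance instMeasurableSpacePairs : MeasurableSpace S.Pairs := borel S.Pairs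

instance instBorelSpacePairs : BorelSpace S.Pairs := ⟨rfl⟩

/-- The action of the deck group on `∂₂^∞ Σ~`. -/
instance instActionPairs : MulAction S.group S.Pairs where
  smul g P := ⟨(fun p ↦ (g : PSL2R) • p) '' P.1, by
    rintro _ ⟨p, hp, rfl⟩
    exact smul_mem_boundaryAtInfinity (S.cover_invariant g g.2) (P.2.1 hp), by
    rw [ncard_image_of_injective _ (MulAction.injective _)]
    exact P.2.2⟩
  one_smul P := Subtype.ext (by
    change (fun p ↦ ((1 : S.group) : PSL2R) • p) '' P.1 = P.1
    simp)
  mul_smul g h P := Subtype.ext (by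
    change (fun p ↦ ((g * h : S.group) : PSL2R) • p) '' P.1 =
      (fun p ↦ (g : PSL2R) • p) '' ((fun p ↦ (h : PSL2R) • p) '' P.1)
    simp [image_image, mul_smul])

/-! ## Geodesic currents -/

/-- The space `GC(Σ)` of geodesic currents: invariant, locally finite (finite on compact sets)
Borel measures on `∂₂^∞ Σ~`. -/
def Current : Type :=
  {μ : Measure S.Pairs // IsFiniteMeasureOnCompacts μ ∧ SMulInvariantMeasure S.group S.Pairs μ}

/-- The weak-* topology: the coarsest topology for which `μ ↦ ∫ f dμ` is continuous for every
compactly supported continuous function `f`. -/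
instance instTopologicalSpaceCurrent : TopologicalSpace S.Current :=
  TopologicalSpace.induced (fun (μ : S.Current) (f : C_c(S.Pairs, ℝ)) ↦ ∫ P, f P ∂μ.1)
    inferInstance

/-- The counting measure `η_P = ∑ δ_{gP}`, summed over `g Stab(P) ∈ G / Stab(P)`. -/
def pairMeasure (P : S.Pairs) : Measure S.Pairs :=
  Measure.sum fun c : S.group ⧸ MulAction.stabilizer S.group P ↦
    Measure.dirac (MulAction.ofQuotientStabilizer S.group P c)

open Classical in
/-- For hyperbolic `g`, the counting measure `η_g = ∑ δ_{h {g^∞, g^{-∞}}}`, summed over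
`h⟨g⟩ ∈ G / ⟨g⟩` (`Quotient.out` picks a representative `h` of the coset, and the summand does not
depend on it). It is `0` for the elements that do not have exactly two fixed points, that is, for
parabolic elements and for `1`. -/
def elementMeasure (g : S.group) : Measure S.Pairs :=
  if hg : fixedPointSet g ⊆ S.boundary ∧ (fixedPointSet g).ncard = 2 then
    Measure.sum fun c : S.group ⧸ Subgroup.zpowers g ↦
      Measure.dirac ((Quotient.out c : S.group) • S.toPairs _ hg)
  else 0

/-- The geometric intersection number of the closed geodesics of `Σ` that are represented by
hyperbolic `g` and `h`: the number of their transverse intersections, counted with multiplicity.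
These correspond to the `G`-orbits of pairs `(a • axis g, b • axis h)` of crossing lifts,
indexed by `(a⟨g⟩, b⟨h⟩) ∈ G/⟨g⟩ × G/⟨h⟩`, that is, to the double cosets `⟨g⟩ k ⟨h⟩`
for which `axis g` and `k • axis h` meet in exactly one point. -/
def intersectionNumber (g h : S.group) : ℕ :=
  ncard ((fun k : S.group ↦ DoubleCoset.mk (Subgroup.zpowers g) (Subgroup.zpowers h) k) ''
    {k | ∃ z : ℍ, axis g ∩ (fun w ↦ (k : PSL2R) • w) '' axis h = {z}})

end CuspedSurface

namespace CuspedSurface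

/-! Move the two cusps to `∞` and `0` by some `N`. Then `α` becomes `z ↦ z + a`, `β` becomes `z ↦ z
/ (b z + 1)`, and `αⁿ βⁿ` has trace `2 + n² a b`. Freeness of the action excludes `-4 < a b < 0`,
where `α β` would be elliptic; hence `αⁿ βⁿ` is hyperbolic for `n ≥ 2`. Its fixed points satisfy `x₁
+ x₂ = n a` and `x₁ x₂ = -a / b`, so `x₁` goes to infinity and `x₂` to `0` (`exists_fixedPoints`).
The axis therefore converges to the line joining the cusps. Its translate by `α⁻ⁿ` has endpoints
`-x₂, -x₁` and converges to the same line; this is the origin of the factor `2`.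

No other lift contributes. A compact set of pairs is controlled by a compact `L ⊆ ℍ` that meets
every line in question (`exists_isOpen_geodesicLine_inter`), and the orbit of `L` stays out of the
cusps (`exists_im_le`). One period of the axis consists of two arcs, each running between the two
cusp excursions. On each arc, up to `α⁻ⁿ`, the points outside the cusps lie in a box independent of
`n` (`exists_box_of_half`, `exists_box_of_axis`). By proper discontinuity all lifts meeting `L` are
`h R` or `h α⁻ⁿ R`, with `R` the fixed pair of `αⁿ βⁿ` and `h` in a finite set independent of `n`
(`exists_finite_of_smul_axis`). Since the stabilizer of a pair of cusps is trivial, these lifts are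
distinct for large `n`, and the integrals are finite sums that converge termwise
(`tendsto_integral_elementMeasure`).

For the second claim, the translates of the axis by `α, …, αⁿ⁻¹` all cross it, in distinct double
cosets, so `αⁿ βⁿ` has at least `n - 1` self-intersections (`le_intersectionNumber`). Along the
convergent sequence of currents a continuous `i` would stay bounded. Two different cusps exist
because a group fixing a single cusp would have a quotient of infinite area (`exists_not_fixed`). -/

/-! ### Möbius transformations in coordinates -/

/-- The matrix with rows `(a, b)` and `(c, d)` as an element of `SL(2, ℝ)`. -/
def slOf (a b c d : ℝ) (h : a * d - b * c = 1) : SL(2, ℝ) :=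
  ⟨!![a, b; c, d], by rw [Matrix.det_fin_two_of]; exact h⟩

/-- The class in `PSL(2, ℝ)` of the matrix with rows `(a, b)` and `(c, d)`. -/
def mobius (a b c d : ℝ) (h : a * d - b * c = 1) : PSL2R :=
  QuotientGroup.mk (slOf a b c d h)

lemma mobius_congr {a b c d a' b' c' d' : ℝ} {h : a * d - b * c = 1} {h' : a' * d' - b' * c' = 1}
    (ha : a = a') (hb : b = b') (hc : c = c') (hd : d = d') :
    mobius a b c d h = mobius a' b' c' d' h' := by
  subst ha hb hc hd; rfl

lemma coe_eq_mobius (A : SL(2, ℝ)) :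
    (A : PSL2R) = mobius (A 0 0) (A 0 1) (A 1 0) (A 1 1)
      (by have := A.det_coe; rwa [Matrix.det_fin_two] at this) := by
  unfold mobius
  refine congrArg QuotientGroup.mk (Subtype.ext ?_)
  ext i j
  fin_cases i <;> fin_cases j <;> rfl

lemma exists_eq_mobius (g : PSL2R) : ∃ a b c d h, g = mobius a b c d h := by
  obtain ⟨A, rfl⟩ := QuotientGroup.mk_surjective g
  exact ⟨_, _, _, _, _, coe_eq_mobius A⟩

lemma mobius_mul {a b c d a' b' c' d' : ℝ} (h : a * d - b * c = 1) (h' : a' * d' - b' * c' = 1) :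
    mobius a b c d h * mobius a' b' c' d' h' =
      mobius (a * a' + b * c') (a * b' + b * d') (c * a' + d * c') (c * b' + d * d')
        (by linear_combination a' * d' * h - b' * c' * h + h') := by
  unfold mobius
  rw [← QuotientGroup.mk_mul]
  refine congrArg QuotientGroup.mk (Subtype.ext ?_)
  rw [Matrix.SpecialLinearGroup.coe_mul]
  ext i j
  fin_cases i <;> fin_cases j <;> simp [slOf, Matrix.mul_apply, Fin.sum_univ_two]

lemma mobius_one : mobius 1 0 0 1 (by norm_num) = 1 := by
  unfold mobius
  refine (congrArg QuotientGroup.mk (?_ : slOf 1 0 0 1 (by norm_num) = 1)).trans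
    (QuotientGroup.mk_one _)
  ext i j
  fin_cases i <;> fin_cases j <;> rfl

lemma mobius_inv {a b c d : ℝ} (h : a * d - b * c = 1) :
    (mobius a b c d h)⁻¹ = mobius d (-b) (-c) a (by linear_combination h) := by
  rw [inv_eq_iff_mul_eq_one, mobius_mul, ← mobius_one]
  exact mobius_congr (by linear_combination h) (by ring) (by ring) (by linear_combination h)

lemma mobius_neg {a b c d : ℝ} (h : a * d - b * c = 1) :
    mobius (-a) (-b) (-c) (-d) (by linear_combination h) = mobius a b c d h := by
  unfold mobius
  rw [QuotientGroup.eq, Matrix.SpecialLinearGroup.mem_center_iff]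
  refine ⟨-1, by norm_num, ?_⟩
  rw [Matrix.SpecialLinearGroup.coe_mul, Matrix.SpecialLinearGroup.coe_inv]
  ext i j
  fin_cases i <;> fin_cases j <;>
    simp [slOf, Matrix.adjugate_fin_two, Matrix.mul_apply, Fin.sum_univ_two] <;> linarith

lemma coe_mobius_smul {a b c d : ℝ} (h : a * d - b * c = 1) (z : ℍ) :
    ((mobius a b c d h • z : ℍ) : ℂ) = (a * z + b) / (c * z + d) := by
  rw [mobius, mk_smul_upperHalfPlane, UpperHalfPlane.coe_specialLinearGroup_apply]
  simp [slOf]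

lemma mobius_denom_pos {a b c d : ℝ} (h : a * d - b * c = 1) (z : ℍ) :
    0 < (c * z.re + d) ^ 2 + (c * z.im) ^ 2 := by
  rcases eq_or_ne c 0 with rfl | hc
  · have : d ≠ 0 := by rintro rfl; simp at h
    have := sq_pos_of_ne_zero this
    simpa using this
  · have := sq_pos_of_ne_zero (mul_ne_zero hc z.im_pos.ne')
    positivity

lemma mobius_smul_re {a b c d : ℝ} (h : a * d - b * c = 1) (z : ℍ) :
    (mobius a b c d h • z).re =
      ((a * z.re + b) * (c * z.re + d) + a * c * z.im ^ 2) /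
        ((c * z.re + d) ^ 2 + (c * z.im) ^ 2) := by
  have hp := mobius_denom_pos h z
  rw [← UpperHalfPlane.coe_re, coe_mobius_smul, Complex.div_re]
  simp [Complex.normSq_apply]
  field_simp

lemma mobius_smul_im {a b c d : ℝ} (h : a * d - b * c = 1) (z : ℍ) :
    (mobius a b c d h • z).im = z.im / ((c * z.re + d) ^ 2 + (c * z.im) ^ 2) := by
  have hp := mobius_denom_pos h z
  rw [← UpperHalfPlane.coe_im, coe_mobius_smul, Complex.div_im]
  simp only [Complex.add_im, Complex.mul_im, Complex.add_re, Complex.mul_re, Complex.ofReal_re,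
    Complex.ofReal_im, UpperHalfPlane.coe_re, UpperHalfPlane.coe_im, Complex.normSq_apply]
  simp only [zero_mul, sub_zero, add_zero, ← pow_two]
  rw [← sub_div]
  congr 1
  linear_combination z.im * h

lemma mobius_smul_infty {a b c d : ℝ} (h : a * d - b * c = 1) :
    mobius a b c d h • (∞ : OnePoint ℝ) = if c = 0 then ∞ else ((a / c : ℝ) : OnePoint ℝ) := by
  rw [mobius, mk_smul_onePoint, OnePoint.smul_infty_eq_ite]
  rfl

lemma mobius_smul_coe {a b c d : ℝ} (h : a * d - b * c = 1) (x : ℝ) :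
    mobius a b c d h • (x : OnePoint ℝ) =
      if c * x + d = 0 then ∞ else (((a * x + b) / (c * x + d) : ℝ) : OnePoint ℝ) := by
  rw [mobius, mk_smul_onePoint, OnePoint.smul_some_eq_ite]
  rfl

/-- The translation `z ↦ z + a`. -/
def translation (a : ℝ) : PSL2R := mobius 1 a 0 1 (by norm_num)

/-- The parabolic transformation `z ↦ z / (b z + 1)`, which fixes `0`. -/
def lowerTranslation (b : ℝ) : PSL2R := mobius 1 0 b 1 (by norm_num)

/-- The dilation `z ↦ s² z`. -/
def dilation (s : ℝ) (hs : s ≠ 0) : PSL2R := mobius s 0 0 s⁻¹ (by field_simp; ring)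

/-- The inversion `z ↦ -1 / z`. -/
def inversion : PSL2R := mobius 0 (-1) 1 0 (by norm_num)

lemma translation_pow (a : ℝ) (n : ℕ) : translation a ^ n = translation (n * a) := by
  induction n with
  | zero =>
    rw [pow_zero, ← mobius_one, translation]
    exact mobius_congr rfl (by simp) rfl rfl
  | succ n ih =>
    rw [pow_succ, ih, translation, translation, translation, mobius_mul]
    apply mobius_congr <;> push_cast <;> ring

lemma lowerTranslation_pow (b : ℝ) (n : ℕ) :
    lowerTranslation b ^ n = lowerTranslation (n * b) := by
  induction n with
  | zero =>
    rw [pow_zero, ← mobius_one, lowerTranslation]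
    exact mobius_congr rfl rfl (by simp) rfl
  | succ n ih =>
    rw [pow_succ, ih, lowerTranslation, lowerTranslation, lowerTranslation, mobius_mul]
    apply mobius_congr <;> push_cast <;> ring

lemma translation_inv (a : ℝ) : (translation a)⁻¹ = translation (-a) := by
  rw [translation, translation, mobius_inv]
  apply mobius_congr <;> ring

lemma lowerTranslation_eq_conj (b : ℝ) :
    lowerTranslation b = inversion * translation (-b) * inversion⁻¹ := by
  rw [lowerTranslation, inversion, translation, mobius_inv, mobius_mul, mobius_mul]
  apply mobius_congr <;> ring

lemma translation_smul_re (a : ℝ) (z : ℍ) : (translation a • z).re = z.re + a := by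
  rw [translation, mobius_smul_re]; simp

lemma translation_smul_im (a : ℝ) (z : ℍ) : (translation a • z).im = z.im := by
  rw [translation, mobius_smul_im]; simp

lemma dilation_smul_re (s : ℝ) (hs : s ≠ 0) (z : ℍ) : (dilation s hs • z).re = s ^ 2 * z.re := by
  rw [dilation, mobius_smul_re]; simp; field_simp

lemma dilation_smul_im (s : ℝ) (hs : s ≠ 0) (z : ℍ) : (dilation s hs • z).im = s ^ 2 * z.im := by
  rw [dilation, mobius_smul_im]; simp; field_simp

lemma inversion_inv_smul_im (z : ℍ) :
    (inversion⁻¹ • z).im = z.im / (z.re ^ 2 + z.im ^ 2) := by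
  rw [inversion, mobius_inv, mobius_smul_im]; simp

lemma inversion_smul_infty : inversion • (∞ : OnePoint ℝ) = ((0 : ℝ) : OnePoint ℝ) := by
  rw [inversion, mobius_smul_infty]; simp

lemma translation_smul_infty (a : ℝ) : translation a • (∞ : OnePoint ℝ) = ∞ := by
  rw [translation, mobius_smul_infty]; simp

lemma translation_smul_coe (a x : ℝ) :
    translation a • (x : OnePoint ℝ) = ((x + a : ℝ) : OnePoint ℝ) := by
  rw [translation, mobius_smul_coe]; simp

lemma translation_ne_one {a : ℝ} (ha : a ≠ 0) : translation a ≠ 1 := by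
  intro h
  have := translation_smul_coe a 0
  rw [h, one_smul, OnePoint.coe_eq_coe] at this
  exact ha (by linarith)

lemma exists_dilation_mul_translation_of_smul_infty {g : PSL2R}
    (hg : g • (∞ : OnePoint ℝ) = ∞) :
    ∃ s b : ℝ, ∃ hs : s ≠ 0, g = mobius s b 0 s⁻¹ (by field_simp; ring) := by
  obtain ⟨a, b, c, d, h, rfl⟩ := exists_eq_mobius g
  rw [mobius_smul_infty] at hg
  have hc : c = 0 := by
    by_contra hc
    rw [if_neg hc] at hg
    exact OnePoint.coe_ne_infty _ hg
  subst hc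
  have ha : a ≠ 0 := by rintro rfl; simp at h
  refine ⟨a, b, ha, mobius_congr rfl rfl rfl ?_⟩
  field_simp
  linarith

lemma exists_eq_dilation {g : PSL2R} (hg : g • (∞ : OnePoint ℝ) = ∞)
    (hg0 : g • ((0 : ℝ) : OnePoint ℝ) = ((0 : ℝ) : OnePoint ℝ)) :
    ∃ s : ℝ, ∃ hs : s ≠ 0, g = dilation s hs := by
  obtain ⟨s, b, hs, rfl⟩ := exists_dilation_mul_translation_of_smul_infty hg
  refine ⟨s, hs, mobius_congr rfl ?_ rfl rfl⟩
  rw [mobius_smul_coe] at hg0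
  simpa [hs] using hg0

/-- `PSL(2, ℝ)` acts doubly transitively on the circle at infinity. -/
lemma exists_smul_infty_smul_zero {p q : OnePoint ℝ} (hpq : p ≠ q) :
    ∃ N : PSL2R, N • (∞ : OnePoint ℝ) = p ∧ N • ((0 : ℝ) : OnePoint ℝ) = q := by
  cases p with
  | infty =>
    cases q with
    | infty => exact absurd rfl hpq
    | coe y => exact ⟨translation y, translation_smul_infty y, by simp [translation_smul_coe]⟩
  | coe x =>
    cases q with
    | infty =>
      refine ⟨translation x * inversion, ?_, ?_⟩
      · rw [mul_smul, inversion_smul_infty, translation_smul_coe, zero_add]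
      · rw [mul_smul, inversion, mobius_smul_coe]
        simp [translation_smul_infty]
    | coe y =>
      have hxy : x - y ≠ 0 := by
        intro h
        exact hpq (by rw [sub_eq_zero.mp h])
      refine ⟨mobius (x / (x - y)) y (1 / (x - y)) 1 (by field_simp), ?_, ?_⟩
      · rw [mobius_smul_infty, if_neg (one_div_ne_zero hxy)]
        congr 1
        field_simp
      · rw [mobius_smul_coe]
        simp

lemma exists_smul_infty (p : OnePoint ℝ) : ∃ N : PSL2R, N • (∞ : OnePoint ℝ) = p := by
  by_cases hp : p = ∞
  · exact ⟨1, by rw [one_smul, hp]⟩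
  · obtain ⟨N, hN, -⟩ := exists_smul_infty_smul_zero hp
    exact ⟨N, hN⟩

/-! ### Parabolic and hyperbolic elements -/

lemma isParabolic_conj_iff (N g : PSL2R) : IsParabolic (N * g * N⁻¹) ↔ IsParabolic g := by
  suffices H : ∀ N g : PSL2R, IsParabolic g → IsParabolic (N * g * N⁻¹) by
    refine ⟨fun h ↦ ?_, H N g⟩
    have := H N⁻¹ _ h
    simpa [mul_assoc] using this
  rintro N g ⟨A, rfl, hA⟩
  obtain ⟨B, rfl⟩ := QuotientGroup.mk_surjective N
  refine ⟨B * A * B⁻¹, rfl, ?_⟩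
  have := (Matrix.isParabolic_conj_iff (m := A.1) (Matrix.SpecialLinearGroup.toGL B)).mpr hA
  rwa [← Matrix.coe_units_inv, ← map_inv] at this

lemma isHyperbolic_conj_iff (N g : PSL2R) : IsHyperbolic (N * g * N⁻¹) ↔ IsHyperbolic g := by
  suffices H : ∀ N g : PSL2R, IsHyperbolic g → IsHyperbolic (N * g * N⁻¹) by
    refine ⟨fun h ↦ ?_, H N g⟩
    have := H N⁻¹ _ h
    simpa [mul_assoc] using this
  rintro N g ⟨A, rfl, hA⟩
  obtain ⟨B, rfl⟩ := QuotientGroup.mk_surjective N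
  refine ⟨B * A * B⁻¹, rfl, ?_⟩
  have := (Matrix.isHyperbolic_conj_iff (m := A.1) (Matrix.SpecialLinearGroup.toGL B)).mpr hA
  rwa [← Matrix.coe_units_inv, ← map_inv] at this

lemma eq_or_eq_neg_of_coe_eq {A B : SL(2, ℝ)} (h : (A : PSL2R) = B) :
    B.1 = A.1 ∨ B.1 = -A.1 := by
  rw [QuotientGroup.eq, Matrix.SpecialLinearGroup.mem_center_iff] at h
  obtain ⟨r, hr, hrA⟩ := h
  have h1 : B.1 = r • A.1 := by
    have : A.1 * (A⁻¹ * B).1 = B.1 := by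
      rw [← Matrix.SpecialLinearGroup.coe_mul, mul_inv_cancel_left]
    rw [← this, ← hrA, Matrix.scalar_apply, ← Matrix.smul_one_eq_diagonal, Matrix.mul_smul, mul_one]
  simp only [Fintype.card_fin] at hr
  rcases mul_self_eq_one_iff.mp ((sq r).symm.trans hr) with rfl | rfl
  · left; simpa using h1
  · right; simpa using h1

lemma isParabolic_coe_iff (A : SL(2, ℝ)) : IsParabolic (A : PSL2R) ↔ A.1.IsParabolic := by
  refine ⟨?_, fun h ↦ ⟨A, rfl, h⟩⟩
  rintro ⟨B, hB, hp⟩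
  rcases eq_or_eq_neg_of_coe_eq hB with h | h
  · rwa [h]
  · rw [h]; exact hp.neg

lemma isHyperbolic_coe_iff (A : SL(2, ℝ)) : IsHyperbolic (A : PSL2R) ↔ A.1.IsHyperbolic := by
  refine ⟨?_, fun h ↦ ⟨A, rfl, h⟩⟩
  rintro ⟨B, hB, hp⟩
  rcases eq_or_eq_neg_of_coe_eq hB with h | h
  · rwa [h]
  · rw [h]; exact hp.neg

lemma isHyperbolic_mobius_iff {a b c d : ℝ} (h : a * d - b * c = 1) :
    IsHyperbolic (mobius a b c d h) ↔ 4 < (a + d) ^ 2 := by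
  rw [mobius, isHyperbolic_coe_iff, slOf, Matrix.IsHyperbolic, Matrix.discr_fin_two,
    Matrix.trace_fin_two_of, Matrix.det_fin_two_of, h]
  constructor <;> intro h <;> linarith

lemma exists_eq_translation {g : PSL2R} (hg : IsParabolic g) (hinf : g • (∞ : OnePoint ℝ) = ∞) :
    ∃ a : ℝ, a ≠ 0 ∧ g = translation a := by
  obtain ⟨s, b, hs, rfl⟩ := exists_dilation_mul_translation_of_smul_infty hinf
  rw [mobius, isParabolic_coe_iff, slOf, Matrix.isParabolic_iff_of_upperTriangular (by simp)] at hg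
  simp only [Matrix.of_apply, Matrix.cons_val', Matrix.cons_val_zero, Matrix.cons_val_one] at hg
  obtain ⟨h1, h2⟩ := hg
  have h3 : s ^ 2 = 1 := by
    field_simp at h1
    exact h1
  rcases mul_self_eq_one_iff.mp ((sq s).symm.trans h3) with rfl | rfl
  · exact ⟨b, h2, mobius_congr rfl rfl rfl (by norm_num)⟩
  · refine ⟨-b, neg_ne_zero.mpr h2, ?_⟩
    rw [translation, ← mobius_neg]
    exact mobius_congr (by norm_num) rfl (by norm_num) (by norm_num)

lemma exists_eq_conj_translation {g N : PSL2R} (hg : IsParabolic g)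
    (hN : g • N • (∞ : OnePoint ℝ) = N • (∞ : OnePoint ℝ)) :
    ∃ a : ℝ, a ≠ 0 ∧ g = N * translation a * N⁻¹ := by
  obtain ⟨a, ha, h⟩ := exists_eq_translation (g := N⁻¹ * g * N)
    (by rw [← isParabolic_conj_iff N]; simpa [mul_assoc] using hg)
    (by rw [mul_smul, mul_smul, hN, inv_smul_smul])
  exact ⟨a, ha, by rw [← h]; group⟩

lemma exists_eq_conj_lowerTranslation {g N : PSL2R} (hg : IsParabolic g)
    (hN : g • N • ((0 : ℝ) : OnePoint ℝ) = N • ((0 : ℝ) : OnePoint ℝ)) :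
    ∃ b : ℝ, b ≠ 0 ∧ g = N * lowerTranslation b * N⁻¹ := by
  rw [← inversion_smul_infty, ← mul_smul N] at hN
  obtain ⟨a, ha, h⟩ := exists_eq_conj_translation hg hN
  refine ⟨-a, neg_ne_zero.mpr ha, ?_⟩
  rw [h, lowerTranslation_eq_conj, neg_neg]
  group

/-! ### Geodesic lines -/

lemma smul_mem_geodesicLine {P : Set (OnePoint ℝ)} {z : ℍ} (g : PSL2R) (hz : z ∈ geodesicLine P) :
    g • z ∈ geodesicLine ((fun p ↦ g • p) '' P) := by
  obtain ⟨A, rfl, rfl⟩ := hz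
  refine ⟨g * A, ?_, mul_smul _ _ _⟩
  rw [image_pair, mul_smul, mul_smul]

lemma smul_mem_geodesicLine_iff {P : Set (OnePoint ℝ)} {z : ℍ} (g : PSL2R) :
    g • z ∈ geodesicLine ((fun p ↦ g • p) '' P) ↔ z ∈ geodesicLine P := by
  refine ⟨fun h ↦ ?_, smul_mem_geodesicLine g⟩
  have := smul_mem_geodesicLine g⁻¹ h
  simpa [image_image] using this

/-- An isometry that preserves `{0, ∞}` is a dilation, or a dilation followed by the inversion; both
keep `I` on the imaginary axis. -/
lemma mem_geodesicLine_zero_infty {z : ℍ} :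
    z ∈ geodesicLine {((0 : ℝ) : OnePoint ℝ), ∞} ↔ z.re = 0 := by
  constructor
  · rintro ⟨A, hA, rfl⟩
    rw [Set.pair_eq_pair_iff] at hA
    rcases hA with ⟨h0, hinf⟩ | ⟨h0, hinf⟩
    · obtain ⟨s, hs, rfl⟩ := exists_eq_dilation hinf h0
      rw [dilation_smul_re]; simp
    · obtain ⟨s, hs, h⟩ := exists_eq_dilation (g := inversion⁻¹ * A)
        (by rw [mul_smul, hinf, ← inversion_smul_infty, inv_smul_smul])
        (by rw [mul_smul, h0, inversion, mobius_inv, mobius_smul_infty]; simp)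
      rw [inv_mul_eq_iff_eq_mul] at h
      rw [h, inversion, dilation, mobius_mul, mobius_smul_re]
      simp
  · intro hz
    have hs : √z.im ≠ 0 := (Real.sqrt_pos.mpr z.im_pos).ne'
    refine ⟨dilation _ hs, ?_, ?_⟩
    · rw [dilation, mobius_smul_coe, mobius_smul_infty]; simp [hs]
    · ext1
      apply Complex.ext
      · rw [UpperHalfPlane.coe_re, UpperHalfPlane.coe_re, dilation_smul_re, hz]; simp
      · rw [UpperHalfPlane.coe_im, UpperHalfPlane.coe_im, dilation_smul_im,
          Real.sq_sqrt z.im_pos.le]; simp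

lemma mem_geodesicLine_smul {N : PSL2R} {z : ℍ} :
    z ∈ geodesicLine {N • ((0 : ℝ) : OnePoint ℝ), N • (∞ : OnePoint ℝ)} ↔ (N⁻¹ • z).re = 0 := by
  rw [← mem_geodesicLine_zero_infty, ← smul_mem_geodesicLine_iff (z := N⁻¹ • z) N, image_pair,
    smul_inv_smul]

lemma mem_geodesicLine_coe {x y : ℝ} (hxy : x ≠ y) {z : ℍ} :
    z ∈ geodesicLine {(x : OnePoint ℝ), (y : OnePoint ℝ)} ↔
      z.re ^ 2 + z.im ^ 2 - (x + y) * z.re + x * y = 0 := by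
  have hyx : y - x ≠ 0 := sub_ne_zero.mpr hxy.symm
  set N := mobius (y / (y - x)) x (1 / (y - x)) 1 (by field_simp) with hN
  have h0 : N • ((0 : ℝ) : OnePoint ℝ) = x := by rw [hN, mobius_smul_coe]; simp
  have h1 : N • (∞ : OnePoint ℝ) = y := by
    rw [hN, mobius_smul_infty, if_neg (one_div_ne_zero hyx)]
    congr 1
    field_simp
  rw [← h0, ← h1, mem_geodesicLine_smul, hN, mobius_inv, mobius_smul_re, div_eq_zero_iff,
    or_iff_left (mobius_denom_pos (a := 1) (b := -x) (by field_simp) z).ne']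
  field_simp
  constructor <;> intro h <;> linear_combination -h

end CuspedSurface

namespace CuspedSurface

/-! ### Discreteness of the deck group -/

instance instIsIsometricSMulUpperHalfPlane : IsIsometricSMul PSL2R ℍ where
  isometry_smul g := by
    obtain ⟨A, rfl⟩ := QuotientGroup.mk_surjective g
    exact isometry_smul ℍ A

/-- High points are moved only a little: the displacement `d` at height `y` satisfies `cosh d = 1 +
a² / (2 y²)`. -/
lemma exists_im_le_of_le_dist_translation_smul (a : ℝ) {ε : ℝ} (hε : 0 < ε) :
    ∃ M, ∀ w : ℍ, ε ≤ dist w (translation a • w) → w.im ≤ M := by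
  have hc : 0 < Real.cosh ε - 1 := by linarith [Real.one_lt_cosh.mpr hε.ne']
  refine ⟨√(a ^ 2 / (2 * (Real.cosh ε - 1))), fun w hw ↦ Real.le_sqrt_of_sq_le ?_⟩
  have h1 : Real.cosh ε ≤ Real.cosh (dist w (translation a • w)) :=
    Real.cosh_le_cosh.mpr (by rwa [abs_of_pos hε, abs_of_nonneg dist_nonneg])
  have h2 : dist (w : ℂ) (translation a • w : ℍ) = |a| := by
    rw [dist_comm, Complex.dist_eq, translation, coe_mobius_smul]
    simp
  rw [UpperHalfPlane.cosh_dist, h2, translation_smul_im, sq_abs] at h1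
  have h3 := w.im_pos
  rw [le_div_iff₀ (by positivity)]
  have h4 : Real.cosh ε - 1 ≤ a ^ 2 / (2 * w.im * w.im) := by linarith
  rw [le_div_iff₀ (by positivity)] at h4
  linarith

variable (S : CuspedSurface)

lemma finite_smul_mem {K L : Set ℍ} (hK : IsCompact K) (hL : IsCompact L) :
    {g : S.group | ∃ z ∈ K, (g : PSL2R) • z ∈ L}.Finite := by
  have := S.properlyDiscontinuous
  refine (ProperlyDiscontinuousSMul.finite_disjoint_inter_image (Γ := S.group) hK hL).subset ?_
  rintro g ⟨z, hz, hgz⟩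
  exact ⟨(g : PSL2R) • z, ⟨z, hz, rfl⟩, hgz⟩

/-- Only finitely many elements move a point of `L` by at most `1`, and each nontrivial one has a
positive minimal displacement on `L` because it has no fixed point. -/
lemma exists_displacement {L : Set ℍ} (hL : IsCompact L) :
    ∃ ε > 0, ∀ g ∈ S.group, g ≠ 1 → ∀ z ∈ L, ε ≤ dist z (g • z) := by
  rcases L.eq_empty_or_nonempty with rfl | hne
  · exact ⟨1, one_pos, by simp⟩
  have hfin := S.finite_smul_mem hL (hL.cthickening (r := 1))
  have key : ∀ g : S.group, ∃ ε > 0, g ≠ 1 → ∀ z ∈ L, ε ≤ dist z ((g : PSL2R) • z) := by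
    intro g
    obtain ⟨x, hx, hmin⟩ := hL.exists_isMinOn hne
      (f := fun z ↦ dist z ((g : PSL2R) • z)) (by fun_prop)
    by_cases hg : g = 1
    · exact ⟨1, one_pos, fun h ↦ absurd hg h⟩
    · refine ⟨_, dist_pos.mpr fun h ↦ hg ?_, fun _ z hz ↦ hmin hz⟩
      exact Subtype.ext (S.free g g.2 x h.symm)
  choose ε hε hεg using key
  have hex : ∃ δ > 0, ∀ g ∈ hfin.toFinset, δ ≤ ε g := by
    by_cases hn : hfin.toFinset.Nonempty
    · obtain ⟨g, hg, hmin⟩ := hfin.toFinset.exists_min_image ε hn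
      exact ⟨ε g, hε g, hmin⟩
    · rw [Finset.not_nonempty_iff_eq_empty] at hn
      exact ⟨1, one_pos, fun g hg ↦ by rw [hn] at hg; simp at hg⟩
  obtain ⟨δ, hδ, hδg⟩ := hex
  refine ⟨min δ 1, lt_min hδ one_pos, fun g hg hg1 z hz ↦ ?_⟩
  by_contra! hlt
  have hmem : (⟨g, hg⟩ : S.group) ∈ hfin.toFinset := by
    rw [Set.Finite.mem_toFinset]
    refine ⟨z, hz, Metric.mem_cthickening_of_dist_le _ z 1 _ hz ?_⟩
    rw [dist_comm]
    exact (hlt.trans_le (min_le_right _ _)).le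
  have h1 := hεg ⟨g, hg⟩ (fun h ↦ hg1 (congrArg Subtype.val h)) z hz
  exact absurd (hlt.trans_le (min_le_left _ _)) (not_lt.mpr ((hδg _ hmem).trans h1))

/-- Orbits of a compact set stay away from the cusps. -/
lemma exists_im_le {N : PSL2R} {a : ℝ} (ha : a ≠ 0)
    (hα : N * translation a * N⁻¹ ∈ S.group) {L : Set ℍ} (hL : IsCompact L) :
    ∃ M, ∀ h ∈ S.group, ∀ z : ℍ, h • z ∈ L → (N⁻¹ • z).im ≤ M := by
  obtain ⟨ε, hε, hεL⟩ := S.exists_displacement hL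
  obtain ⟨M, hM⟩ := exists_im_le_of_le_dist_translation_smul a hε
  refine ⟨M, fun h hh z hz ↦ hM _ ?_⟩
  -- The conjugate of the parabolic element by `h` moves `h • z ∈ L` exactly as far as `translation
  -- a` moves `N⁻¹ • z`.
  have h1 := hεL (h * (N * translation a * N⁻¹) * h⁻¹)
    (S.group.mul_mem (S.group.mul_mem hh hα) (S.group.inv_mem hh)) (fun h1 ↦ by
      rw [conj_eq_one_iff, conj_eq_one_iff] at h1
      exact translation_ne_one ha h1) _ hz
  rw [mul_smul, inv_smul_smul, mul_smul, dist_smul, mul_smul, ← dist_smul N⁻¹, mul_smul N,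
    inv_smul_smul] at h1
  exact h1

lemma exists_im_le_lower {N : PSL2R} {b : ℝ} (hb : b ≠ 0)
    (hβ : N * lowerTranslation b * N⁻¹ ∈ S.group) {L : Set ℍ} (hL : IsCompact L) :
    ∃ M, ∀ h ∈ S.group, ∀ z : ℍ, h • z ∈ L →
      (N⁻¹ • z).im / ((N⁻¹ • z).re ^ 2 + (N⁻¹ • z).im ^ 2) ≤ M := by
  obtain ⟨M, hM⟩ := S.exists_im_le (N := N * inversion) (a := -b) (neg_ne_zero.mpr hb)
    (by rw [lowerTranslation_eq_conj] at hβ; convert hβ using 1; group) hL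
  refine ⟨M, fun h hh z hz ↦ ?_⟩
  have := hM h hh z hz
  rwa [mul_inv_rev, mul_smul, inversion_inv_smul_im] at this

/-- A deck transformation that fixes a cusp acts as a Euclidean isometry on the horocycles. -/
lemma sq_eq_one_of_conj_mem {N : PSL2R} {a : ℝ} (ha : a ≠ 0)
    (hα : N * translation a * N⁻¹ ∈ S.group) {s c : ℝ} (hs : s ≠ 0)
    (hg : N * mobius s c 0 s⁻¹ (by field_simp; ring) * N⁻¹ ∈ S.group) : s ^ 2 = 1 := by
  set B := mobius s c 0 s⁻¹ (by field_simp; ring) with hB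
  obtain ⟨M, hM⟩ := S.exists_im_le ha hα (isCompact_singleton (x := N • I))
  have him : ∀ z : ℍ, (B • z).im = s ^ 2 * z.im := by
    intro z
    rw [hB, mobius_smul_im]
    field_simp
    simp
  have hpow : ∀ n : ℕ, (B ^ n • I).im = (s ^ 2) ^ n := by
    intro n
    induction n with
    | zero => simp
    | succ n ih => rw [pow_succ', mul_smul, him, ih]; ring
  have hpow' : ∀ n : ℕ, (B⁻¹ ^ n • I).im = ((s ^ 2)⁻¹) ^ n := by
    intro n
    induction n with
    | zero => simp
    | succ n ih =>
      have h1 := him (B⁻¹ • (B⁻¹ ^ n • I))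
      rw [smul_inv_smul, ih] at h1
      rw [pow_succ', mul_smul, pow_succ', h1]
      rw [inv_mul_cancel_left₀ (by positivity)]
  -- All these points lie in the orbit of `N • I`, whose height in the cusp is bounded. Powers of
  -- `B` and of `B⁻¹` then exclude `s ^ 2 > 1` and `s ^ 2 < 1`.
  have hconj : ∀ (C : PSL2R) (n : ℕ), N * C * N⁻¹ ∈ S.group → (C ^ n • I).im ≤ M := by
    intro C n hC
    have h1 := hM _ (S.group.inv_mem (S.group.pow_mem hC n)) (N • C ^ n • I)
      (by rw [conj_pow, inv_smul_eq_iff.mpr]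
          · rfl
          · simp [mul_smul])
    rwa [inv_smul_smul] at h1
  have hs2 : 0 < s ^ 2 := by positivity
  refine le_antisymm ?_ ?_
  · by_contra! hlt
    obtain ⟨n, hn⟩ := pow_unbounded_of_one_lt M hlt
    exact absurd (hconj B n hg) (not_le.mpr (by rwa [hpow]))
  · by_contra! hlt
    obtain ⟨n, hn⟩ := pow_unbounded_of_one_lt M (one_lt_inv₀ hs2 |>.mpr hlt)
    refine absurd (hconj B⁻¹ n ?_) (not_le.mpr (by rwa [hpow']))
    have := S.group.inv_mem hg
    convert this using 1
    group

/-- The stabilizer of a pair of distinct cusps is trivial. -/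
lemma eq_one_of_smul_pair {N : PSL2R} {a : ℝ} (ha : a ≠ 0)
    (hα : N * translation a * N⁻¹ ∈ S.group) {g : PSL2R} (hg : g ∈ S.group)
    (h : (fun p ↦ g • p) '' {N • (∞ : OnePoint ℝ), N • ((0 : ℝ) : OnePoint ℝ)} =
      {N • (∞ : OnePoint ℝ), N • ((0 : ℝ) : OnePoint ℝ)}) : g = 1 := by
  set B := N⁻¹ * g * N with hB
  have hgB : g = N * B * N⁻¹ := by rw [hB]; group
  have hB' : ({B • (∞ : OnePoint ℝ), B • ((0 : ℝ) : OnePoint ℝ)} : Set (OnePoint ℝ)) =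
      {∞, ((0 : ℝ) : OnePoint ℝ)} := by
    have := congrArg (fun s ↦ (fun p ↦ N⁻¹ • p) '' s) h
    simpa only [image_pair, inv_smul_smul, ← mul_smul, ← mul_assoc, inv_mul_cancel, one_smul]
      using this
  rw [Set.pair_eq_pair_iff] at hB'
  rcases hB' with ⟨h1, h2⟩ | ⟨h1, h2⟩
  · obtain ⟨s, hs, hBs⟩ := exists_eq_dilation h1 h2
    rw [hBs, dilation] at hgB
    have h3 := S.sq_eq_one_of_conj_mem ha hα hs (by rw [← hgB]; exact hg)
    have h4 : mobius s 0 0 s⁻¹ (by field_simp; ring) = 1 := by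
      rcases mul_self_eq_one_iff.mp ((sq s).symm.trans h3) with rfl | rfl
      · rw [← mobius_one]
        exact mobius_congr rfl rfl rfl (by norm_num)
      · rw [← mobius_one, ← mobius_neg]
        exact mobius_congr (by norm_num) (by norm_num) (by norm_num) (by norm_num)
    rw [hgB, h4]
    group
  · obtain ⟨s, hs, hBs⟩ := exists_eq_dilation (g := inversion⁻¹ * B)
      (by rw [mul_smul, h1, ← inversion_smul_infty, inv_smul_smul])
      (by rw [mul_smul, h2, inversion, mobius_inv, mobius_smul_infty]; simp)
    rw [inv_mul_eq_iff_eq_mul, inversion, dilation, mobius_mul] at hBs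
    -- An element that swaps the cusps is `z ↦ -1 / (s² z)` in these coordinates, a half turn about
    -- `i / |s|`; freeness makes it trivial.
    refine S.free g hg (N • (⟨(|s|⁻¹ : ℝ) * Complex.I, by simp [hs]⟩ : ℍ)) ?_
    rw [hgB, mul_smul, inv_smul_smul, mul_smul]
    congr 1
    ext1
    rw [hBs, coe_mobius_smul]
    have hsC : (s : ℂ) ≠ 0 := by exact_mod_cast hs
    have hsA : ((|s| : ℝ) : ℂ) ≠ 0 := by exact_mod_cast abs_ne_zero.mpr hs
    have hsq : ((|s| : ℝ) : ℂ) ^ 2 = (s : ℂ) ^ 2 := by exact_mod_cast sq_abs s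
    have hI := Complex.I_sq
    simp only [mul_zero, zero_mul, neg_mul, one_mul, add_zero, zero_add, Complex.ofReal_neg,
      Complex.ofReal_inv, Complex.ofReal_zero]
    rw [div_eq_iff (by simp [hsC, hsA])]
    field_simp
    rw [hI]
    linear_combination -hsq

end CuspedSurface

namespace CuspedSurface

/-! ### The topology of the space of pairs -/

lemma continuous_boundaryToSphere : Continuous boundaryToSphere :=
  OnePoint.continuous_map Complex.continuous_ofReal (by
    rw [coclosedCompact_eq_cocompact, coclosedCompact_eq_cocompact]
    exact Complex.isometry_ofReal.isClosedEmbedding.tendsto_cocompact)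

lemma injective_boundaryToSphere : Function.Injective boundaryToSphere :=
  Option.map_injective Complex.ofReal_injective

lemma boundaryToSphere_smul (A : SL(2, ℝ)) (p : OnePoint ℝ) :
    boundaryToSphere ((A : PSL2R) • p) =
      (Matrix.SpecialLinearGroup.toGL A).map Complex.ofRealHom • boundaryToSphere p := by
  rw [mk_smul_onePoint]
  exact OnePoint.map_smul Complex.ofRealHom _ p

instance instContinuousConstSMulOnePoint : ContinuousConstSMul PSL2R (OnePoint ℝ) where
  continuous_const_smul g := by
    obtain ⟨A, rfl⟩ := QuotientGroup.mk_surjective g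
    rw [(continuous_boundaryToSphere.isClosedEmbedding
      injective_boundaryToSphere).isEmbedding.continuous_iff]
    refine ((continuous_smul_sphere ((Matrix.SpecialLinearGroup.toGL A).map
      Complex.ofRealHom)).comp continuous_boundaryToSphere).congr fun p ↦ ?_
    exact (boundaryToSphere_smul A p).symm

/-- A compact rectangle in the upper half plane. -/
def box (C δ M : ℝ) : Set ℍ := {z | |z.re| ≤ C ∧ δ ≤ z.im ∧ z.im ≤ M}

lemma isCompact_box (C M : ℝ) {δ : ℝ} (hδ : 0 < δ) : IsCompact (box C δ M) := by
  rw [UpperHalfPlane.isEmbedding_coe.isCompact_iff]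
  convert (isCompact_Icc (a := -C) (b := C)).reProdIm (isCompact_Icc (a := δ) (b := M)) using 1
  ext w
  simp only [box, mem_image, mem_ofPred_eq, Complex.mem_reProdIm, mem_Icc, abs_le]
  constructor
  · rintro ⟨z, hz, rfl⟩
    exact hz
  · intro hw
    exact ⟨⟨w, hδ.trans_le hw.2.1⟩, hw, rfl⟩

variable (S : CuspedSurface)

lemma coe_smul_pairs (g : S.group) (P : S.Pairs) :
    (g • P).1 = (fun p ↦ (g : PSL2R) • p) '' P.1 := rfl

instance instContinuousConstSMulPairs : ContinuousConstSMul S.group S.Pairs where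
  continuous_const_smul g := by
    let := TopologicalSpace.vietoris (OnePoint ℝ)
    refine continuous_induced_rng.mpr ?_
    exact (continuous_const_smul (g : PSL2R)).image_vietoris.comp continuous_induced_dom

lemma isOpen_pairs_subset {U : Set (OnePoint ℝ)} (hU : IsOpen U) :
    IsOpen {P : S.Pairs | P.1 ⊆ U} :=
  let := TopologicalSpace.vietoris (OnePoint ℝ)
  hU.powerset_vietoris.preimage continuous_induced_dom

lemma isOpen_pairs_inter {U : Set (OnePoint ℝ)} (hU : IsOpen U) :
    IsOpen {P : S.Pairs | (P.1 ∩ U).Nonempty} :=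
  let := TopologicalSpace.vietoris (OnePoint ℝ)
  (TopologicalSpace.vietoris.isOpen_inter_nonempty_of_isOpen hU).preimage continuous_induced_dom

lemma finite_pairs (P : S.Pairs) : P.1.Finite :=
  Set.finite_of_ncard_ne_zero (by rw [P.2.2]; norm_num)

/-- Separation is needed to keep lifts with different limits apart. A point of `P` outside `Q` is
separated from the finite set `Q`, and the two kinds of Vietoris open sets do the rest. -/
instance instT2SpacePairs : T2Space S.Pairs where
  t2 P Q hPQ := by
    have h1 : ¬ P.1 ⊆ Q.1 := fun h ↦ hPQ (Subtype.ext
      (Set.eq_of_subset_of_ncard_le h (by rw [P.2.2, Q.2.2]) (S.finite_pairs Q)))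
    obtain ⟨x, hxP, hxQ⟩ := Set.not_subset.mp h1
    obtain ⟨U, V, hU, hV, hxU, hQV, hUV⟩ := SeparatedNhds.of_isCompact_isCompact
      (isCompact_singleton (x := x)) (S.finite_pairs Q).isCompact
      (disjoint_singleton_left.mpr hxQ)
    refine ⟨_, _, S.isOpen_pairs_inter hU, S.isOpen_pairs_subset hV,
      ⟨x, hxP, hxU rfl⟩, hQV, ?_⟩
    rw [Set.disjoint_left]
    rintro R ⟨y, hyR, hyU⟩ hRV
    exact Set.disjoint_left.mp hUV hyU (hRV hyR)

lemma tendsto_pairs {ι : Type*} {l : Filter ι} {P : ι → S.Pairs} {Q : S.Pairs}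
    {x y : ι → OnePoint ℝ} {u v : OnePoint ℝ} (hP : ∀ᶠ i in l, (P i).1 = {x i, y i})
    (hQ : Q.1 = {u, v}) (hx : Tendsto x l (𝓝 u)) (hy : Tendsto y l (𝓝 v)) :
    Tendsto P l (𝓝 Q) := by
  let := TopologicalSpace.vietoris (OnePoint ℝ)
  rw [nhds_induced, tendsto_comap_iff]
  refine TopologicalSpace.tendsto_nhds_generateFrom_iff.mpr ?_
  -- The generating sets are of two kinds: the pairs inside `U` and the pairs that meet `U`.
  rintro _ (⟨U, hU, rfl⟩ | ⟨U, hU, rfl⟩) hQU <;> replace hU : IsOpen U := hU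
  · replace hQU : Q.1 ⊆ U := hQU
    rw [hQ, Set.pair_subset_iff] at hQU
    filter_upwards [hP, hx (hU.mem_nhds hQU.1), hy (hU.mem_nhds hQU.2)] with i h0 h1 h2
    change (P i).1 ⊆ U
    rw [h0, Set.pair_subset_iff]
    exact ⟨h1, h2⟩
  · obtain ⟨w, hw, hwU⟩ := hQU
    replace hw : w ∈ Q.1 := hw
    rw [hQ] at hw
    rcases hw with rfl | rfl
    · filter_upwards [hP, hx (hU.mem_nhds hwU)] with i h0 h1
      exact ⟨x i, by change _ ∈ (P i).1; simp [h0], h1⟩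
    · filter_upwards [hP, hy (hU.mem_nhds hwU)] with i h0 h1
      exact ⟨y i, by change _ ∈ (P i).1; simp [h0], h1⟩

/-- In a chart where the endpoints are `1` and `0`, nearby lines are semicircles whose tops stay in
a fixed box. -/
lemma exists_nhds_geodesicLine_inter (P : S.Pairs) :
    ∃ U : Set S.Pairs, IsOpen U ∧ P ∈ U ∧ ∃ L : Set ℍ, IsCompact L ∧
      ∀ Q ∈ U, (geodesicLine Q.1 ∩ L).Nonempty := by
  obtain ⟨x, y, hxy, hP⟩ := Set.ncard_eq_two.mp P.2.2
  obtain ⟨N₀, hx, hy⟩ := exists_smul_infty_smul_zero hxy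
  -- `z ↦ z / (1 - z)` fixes `0` and sends `1` to `∞`, so both endpoints become finite.
  set N := N₀ * lowerTranslation (-1) with hN
  have h1 : N • ((1 : ℝ) : OnePoint ℝ) = x := by
    rw [hN, mul_smul, lowerTranslation, mobius_smul_coe]
    simpa using hx
  have h0 : N • ((0 : ℝ) : OnePoint ℝ) = y := by
    rw [hN, mul_smul, lowerTranslation, mobius_smul_coe]
    simpa using hy
  have hopen : ∀ a b : ℝ, IsOpen ((fun p ↦ N • p) '' ((↑) '' Ioo a b : Set (OnePoint ℝ))) :=
    fun a b ↦ (isOpenMap_smul N) _ (OnePoint.isOpenEmbedding_coe.isOpenMap _ isOpen_Ioo)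
  set V₁ : Set (OnePoint ℝ) := (fun p ↦ N • p) '' ((↑) '' Ioo (2 / 3 : ℝ) (4 / 3)) with hV₁
  set V₀ : Set (OnePoint ℝ) := (fun p ↦ N • p) '' ((↑) '' Ioo (-1 / 3 : ℝ) (1 / 3)) with hV₀
  have hxV : x ∈ V₁ := ⟨_, ⟨1, by norm_num, rfl⟩, h1⟩
  have hyV : y ∈ V₀ := ⟨_, ⟨0, by norm_num, rfl⟩, h0⟩
  refine ⟨_, ((S.isOpen_pairs_inter (hopen _ _)).inter (S.isOpen_pairs_inter (hopen _ _))),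
    ⟨⟨x, by rw [hP]; simp, hxV⟩, ⟨y, by rw [hP]; simp, hyV⟩⟩,
    (fun z ↦ N • z) '' box 1 (1 / 6) 1,
    (isCompact_box 1 1 (by norm_num)).image (continuous_const_smul N), ?_⟩
  rintro Q ⟨⟨_, hQ₁, ⟨_, ⟨u, hu, rfl⟩, rfl⟩⟩, ⟨_, hQ₀, ⟨_, ⟨v, hv, rfl⟩, rfl⟩⟩⟩
  simp only [mem_Ioo] at hu hv
  have huv : u ≠ v := by intro h; linarith
  have hQ : Q.1 = (fun p ↦ N • p) '' {(u : OnePoint ℝ), (v : OnePoint ℝ)} := by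
    refine (Set.eq_of_subset_of_ncard_le ?_ ?_ (S.finite_pairs Q)).symm
    · rw [image_pair, Set.pair_subset_iff]
      exact ⟨hQ₁, hQ₀⟩
    · rw [Q.2.2, Set.ncard_image_of_injective _ (MulAction.injective N),
        Set.ncard_pair (by simpa using huv)]
  -- The top of the semicircle; its height lies between `1 / 6` and `5 / 6`.
  set z : ℍ := ⟨⟨(u + v) / 2, (u - v) / 2⟩, by simp only; linarith⟩ with hz
  have hre : z.re = (u + v) / 2 := rfl
  have him : z.im = (u - v) / 2 := rfl
  refine ⟨N • z, ?_, z, ?_, rfl⟩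
  · rw [hQ, smul_mem_geodesicLine_iff, mem_geodesicLine_coe huv, hre, him]
    ring
  · refine ⟨?_, ?_, ?_⟩
    · rw [hre, abs_le]; constructor <;> linarith
    · rw [him]; linarith
    · rw [him]; linarith

/-- This turns local finiteness in the space of pairs into proper discontinuity on `ℍ`. -/
lemma exists_isOpen_geodesicLine_inter {K : Set S.Pairs} (hK : IsCompact K) :
    ∃ U : Set S.Pairs, IsOpen U ∧ K ⊆ U ∧ ∃ L : Set ℍ, IsCompact L ∧
      ∀ Q ∈ U, (geodesicLine Q.1 ∩ L).Nonempty := by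
  choose U hU hPU L hL hUL using S.exists_nhds_geodesicLine_inter
  obtain ⟨t, ht⟩ := hK.elim_finite_subcover U hU fun P _ ↦ mem_iUnion.mpr ⟨P, hPU P⟩
  refine ⟨⋃ P ∈ t, U P, isOpen_biUnion fun P _ ↦ hU P, ht, ⋃ P ∈ t, L P,
    t.isCompact_biUnion fun P _ ↦ hL P, fun Q hQ ↦ ?_⟩
  simp only [mem_iUnion] at hQ
  obtain ⟨P, hP, hQP⟩ := hQ
  obtain ⟨z, hz, hzL⟩ := hUL P Q hQP
  exact ⟨z, hz, mem_biUnion hP hzL⟩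

/-! ### Counting measures -/

/-- The counting measure of a family of pairs. -/
def countingMeasure {ι : Type*} (φ : ι → S.Pairs) : Measure S.Pairs :=
  Measure.sum fun c ↦ Measure.dirac (φ c)

variable {S} {ι : Type*} {φ : ι → S.Pairs}

/-- A family of pairs is locally finite if a compact subset of `ℍ` meets only finitely many of
the geodesic lines. -/
def IsLocallyFiniteFamily (φ : ι → S.Pairs) : Prop :=
  ∀ L : Set ℍ, IsCompact L → {c | (geodesicLine (φ c).1 ∩ L).Nonempty}.Finite

lemma isFiniteMeasureOnCompacts_countingMeasure (hφ : IsLocallyFiniteFamily φ) :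
    IsFiniteMeasureOnCompacts (S.countingMeasure φ) where
  lt_top_of_isCompact := by
    intro K hK
    obtain ⟨U, hU, hKU, L, hL, hUL⟩ := S.exists_isOpen_geodesicLine_inter hK
    refine (measure_mono hKU).trans_lt ?_
    rw [countingMeasure, Measure.sum_apply _ hU.measurableSet,
      tsum_eq_sum (s := (hφ L hL).toFinset)]
    · exact ENNReal.sum_lt_top.mpr fun c _ ↦ measure_lt_top _ _
    · intro c hc
      rw [Measure.dirac_apply' _ hU.measurableSet, Set.indicator_of_notMem]
      intro hcU
      exact hc ((Set.Finite.mem_toFinset _).mpr (hUL _ hcU))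

lemma smulInvariantMeasure_countingMeasure [MulAction S.group ι]
    (hφ : ∀ (g : S.group) (c : ι), φ (g • c) = g • φ c) :
    SMulInvariantMeasure S.group S.Pairs (S.countingMeasure φ) where
  measure_preimage_smul g s hs := by
    have hm : MeasurableSet ((fun P : S.Pairs ↦ g • P) ⁻¹' s) :=
      (continuous_const_smul g).measurable hs
    rw [countingMeasure, Measure.sum_apply _ hm, Measure.sum_apply _ hs,
      ← (MulAction.toPerm g).tsum_eq (fun c ↦ Measure.dirac (φ c) s)]
    refine tsum_congr fun c ↦ ?_
    rw [Measure.dirac_apply' _ hm, Measure.dirac_apply' _ hs, MulAction.toPerm_apply, hφ]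
    rfl

lemma integral_countingMeasure (hφ : IsLocallyFiniteFamily φ) (f : C_c(S.Pairs, ℝ)) :
    ∫ P, f P ∂(S.countingMeasure φ) = ∑' c, f (φ c) := by
  have := isFiniteMeasureOnCompacts_countingMeasure hφ
  have hint : Integrable (fun P ↦ f P) (S.countingMeasure φ) :=
    f.continuous.integrable_of_hasCompactSupport f.hasCompactSupport
  rw [countingMeasure] at hint ⊢
  rw [integral_sum_measure hint]
  refine tsum_congr fun c ↦ ?_
  exact integral_dirac' _ _ f.continuous.stronglyMeasurable

end CuspedSurface

namespace CuspedSurface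

/-! ### Fixed points and axes -/

lemma mem_fixedPointSet {g : PSL2R} {p : OnePoint ℝ} : p ∈ fixedPointSet g ↔ g • p = p := Iff.rfl

lemma fixedPointSet_conj (N g : PSL2R) :
    fixedPointSet (N * g * N⁻¹) = (fun p ↦ N • p) '' fixedPointSet g := by
  ext p
  rw [mem_fixedPointSet]
  constructor
  · intro hp
    refine ⟨N⁻¹ • p, ?_, smul_inv_smul _ _⟩
    rw [mem_fixedPointSet]
    nth_rewrite 2 [← hp]
    rw [mul_smul, mul_smul, inv_smul_smul]
  · rintro ⟨x, hx, rfl⟩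
    rw [mul_smul, mul_smul, inv_smul_smul, mem_fixedPointSet.mp hx]

lemma image_smul_fixedPointSet (g : PSL2R) (m : ℤ) :
    (fun p ↦ g ^ m • p) '' fixedPointSet g = fixedPointSet g := by
  have h : ∀ p ∈ fixedPointSet g, g ^ m • p = p := fun p hp ↦
    (MulAction.mem_stabilizer_iff.mp
      (Subgroup.zpow_mem _ (MulAction.mem_stabilizer_iff.mpr hp) m))
  rw [Set.image_congr h, image_id']

lemma zpow_smul_mem_axis {g : PSL2R} {z : ℍ} (hz : z ∈ axis g) (m : ℤ) : g ^ m • z ∈ axis g := by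
  have := smul_mem_geodesicLine (g ^ m) hz
  rwa [image_smul_fixedPointSet] at this

lemma apply_zpow_smul {f : ℍ → ℝ} {g : PSL2R} {R : ℝ} (hR : R ≠ 0)
    (h : ∀ z, f (g • z) = R * f z) (m : ℤ) (z : ℍ) : f (g ^ m • z) = R ^ m * f z := by
  induction m using Int.induction_on with
  | zero => simp
  | succ n ih => rw [add_comm, zpow_add, zpow_one, mul_smul, h, ih, zpow_one_add₀ hR, mul_assoc]
  | pred n ih =>
    have h1 := h (g ^ (-(n : ℤ) - 1) • z)
    rw [← mul_smul, ← zpow_one_add, add_sub_cancel, ih] at h1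
    rw [zpow_sub_one₀ hR]
    field_simp
    linarith

/-- Put the fixed points at `0` and `∞`. If the resulting dilation contracts, the inversion
exchanges the two; `s ^ 2 = 1` would make `g` trivial, with infinitely many fixed points. -/
lemma exists_eq_conj_dilation {g : PSL2R} (hg : (fixedPointSet g).ncard = 2) :
    ∃ (N : PSL2R) (s : ℝ) (hs : s ≠ 0), 1 < s ^ 2 ∧ g = N * dilation s hs * N⁻¹ ∧
      fixedPointSet g = {N • ((0 : ℝ) : OnePoint ℝ), N • (∞ : OnePoint ℝ)} := by
  obtain ⟨x, y, hxy, hP⟩ := Set.ncard_eq_two.mp hg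
  obtain ⟨N, hx, hy⟩ := exists_smul_infty_smul_zero hxy
  have hgx : g • x = x := by rw [← mem_fixedPointSet, hP]; simp
  have hgy : g • y = y := by rw [← mem_fixedPointSet, hP]; simp
  obtain ⟨s, hs, hB⟩ := exists_eq_dilation (g := N⁻¹ * g * N)
    (by rw [mul_smul, mul_smul, hx, hgx, ← hx, inv_smul_smul])
    (by rw [mul_smul, mul_smul, hy, hgy, ← hy, inv_smul_smul])
  have hgs : g = N * dilation s hs * N⁻¹ := by rw [← hB]; group
  rcases lt_trichotomy (s ^ 2) 1 with h | h | h
  · refine ⟨N * inversion, s⁻¹, inv_ne_zero hs, ?_, ?_, ?_⟩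
    · rw [inv_pow]
      exact (one_lt_inv₀ (by positivity)).mpr h
    · have : inversion * dilation s⁻¹ (inv_ne_zero hs) * inversion⁻¹ = dilation s hs := by
        rw [inversion, dilation, dilation, mobius_inv, mobius_mul, mobius_mul]
        apply mobius_congr <;> simp
      rw [hgs, ← this]
      group
    · have h0 : inversion • ((0 : ℝ) : OnePoint ℝ) = ∞ := by
        rw [inversion, mobius_smul_coe]; simp
      rw [hP, mul_smul, mul_smul, inversion_smul_infty, h0, hx, hy]
  · exfalso
    have h1 : dilation s hs = 1 := by
      rcases mul_self_eq_one_iff.mp ((sq s).symm.trans h) with rfl | rfl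
      · rw [← mobius_one]
        exact mobius_congr rfl rfl rfl (by norm_num)
      · rw [← mobius_one, ← mobius_neg]
        exact mobius_congr (by norm_num) (by norm_num) (by norm_num) (by norm_num)
    rw [h1, mul_one, mul_inv_cancel] at hgs
    have h2 : fixedPointSet g = univ := by ext p; simp [mem_fixedPointSet, hgs]
    have : Infinite (OnePoint ℝ) := Infinite.of_injective _ OnePoint.coe_injective
    rw [h2, Set.ncard_univ, Nat.card_eq_zero_of_infinite] at hg
    exact absurd hg (by norm_num)
  · exact ⟨N, s, hs, h, hgs, by rw [hP, hx, hy, Set.pair_comm]⟩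

/-- The quotient of an axis by the cyclic group of translations along it is compact. -/
lemma exists_compact_zpow_smul_mem {g : PSL2R} (hg : (fixedPointSet g).ncard = 2) :
    ∃ D : Set ℍ, IsCompact D ∧ ∀ z ∈ axis g, ∃ m : ℤ, g ^ m • z ∈ D := by
  obtain ⟨N, s, hs, hs1, hgs, hP⟩ := exists_eq_conj_dilation hg
  refine ⟨(fun z ↦ N • z) '' box 0 1 (s ^ 2),
    (isCompact_box 0 _ one_pos).image (continuous_const_smul N), fun z hz ↦ ?_⟩
  rw [axis, hP, mem_geodesicLine_smul] at hz
  have hs0 : s ^ 2 ≠ 0 := by positivity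
  obtain ⟨m, hm1, hm2⟩ := exists_mem_Ico_zpow (N⁻¹ • z).im_pos hs1
  refine ⟨-m, g ^ (-m) • z |> fun w ↦ N⁻¹ • w, ?_, smul_inv_smul _ _⟩
  have h1 : N⁻¹ • g ^ (-m) • z = dilation s hs ^ (-m) • N⁻¹ • z := by
    rw [hgs, conj_zpow, mul_smul, mul_smul, inv_smul_smul]
  have hre := apply_zpow_smul (f := UpperHalfPlane.re) hs0 (dilation_smul_re s hs) (-m) (N⁻¹ • z)
  have him := apply_zpow_smul (f := UpperHalfPlane.im) hs0 (dilation_smul_im s hs) (-m) (N⁻¹ • z)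
  have hpos : 0 < (s ^ 2) ^ m := by positivity
  change N⁻¹ • g ^ (-m) • z ∈ box 0 1 (s ^ 2)
  rw [h1]
  refine ⟨by rw [hre, hz]; simp, ?_, ?_⟩
  · rw [him, zpow_neg, inv_mul_eq_div, le_div_iff₀ hpos, one_mul]
    exact hm1
  · rw [him, zpow_neg, inv_mul_eq_div, div_le_iff₀ hpos, ← zpow_one_add₀ hs0, add_comm]
    exact hm2.le

/-! ### Points of the boundary at infinity -/

lemma toSphere_smul (A : SL(2, ℝ)) (z : ℍ) :
    toSphere ((A : PSL2R) • z) =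
      (Matrix.SpecialLinearGroup.toGL A).map Complex.ofRealHom • toSphere z := by
  have hden : (A 1 0 : ℂ) * z + A 1 1 ≠ 0 :=
    UpperHalfPlane.denom_ne_zero (Matrix.SpecialLinearGroup.toGL A) z
  rw [mk_smul_upperHalfPlane, toSphere, toSphere, OnePoint.smul_some_eq_ite,
    UpperHalfPlane.coe_specialLinearGroup_apply]
  simp [hden]

variable (S : CuspedSurface)

/-- The orbit of a point of the cover under the powers of `N * B * N⁻¹` stays in the cover and
converges to `N • ∞` in the sphere. -/
lemma smul_infty_mem_boundary {N B : PSL2R} (hg : N * B * N⁻¹ ∈ S.group)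
    (hB : ∀ z : ℍ, Tendsto (fun n : ℕ ↦ ‖((B ^ n • z : ℍ) : ℂ)‖) atTop atTop) :
    N • (∞ : OnePoint ℝ) ∈ S.boundary := by
  obtain ⟨z, hz⟩ := S.cover_interior
  replace hz := interior_subset hz
  obtain ⟨A, rfl⟩ := QuotientGroup.mk_surjective N
  change boundaryToSphere _ ∈ closure _
  rw [boundaryToSphere_smul]
  have h1 : Tendsto (fun n : ℕ ↦ toSphere (B ^ n • (A : PSL2R)⁻¹ • z)) atTop
      (𝓝 (boundaryToSphere ∞)) := by
    refine OnePoint.tendsto_coe_infty.comp ?_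
    rw [coclosedCompact_eq_cocompact, ← Metric.cobounded_eq_cocompact,
      ← tendsto_norm_atTop_iff_cobounded]
    exact hB _
  refine mem_closure_of_tendsto (((continuous_smul_sphere
    ((Matrix.SpecialLinearGroup.toGL A).map Complex.ofRealHom)).tendsto _).comp h1)
    (Eventually.of_forall fun n ↦ ?_)
  refine ⟨((A : PSL2R) * B * (A : PSL2R)⁻¹) ^ n • z,
    S.cover_invariant _ (S.group.pow_mem hg n) z hz, ?_⟩
  rw [conj_pow, mul_smul, mul_smul]
  exact toSphere_smul _ _

lemma smul_infty_mem_boundary_of_translation {N : PSL2R} {a : ℝ} (ha : a ≠ 0)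
    (hg : N * translation a * N⁻¹ ∈ S.group) : N • (∞ : OnePoint ℝ) ∈ S.boundary := by
  refine S.smul_infty_mem_boundary hg fun z ↦ ?_
  refine tendsto_atTop_mono (fun n ↦ Complex.abs_re_le_norm _) ?_
  have h : ∀ n : ℕ, (translation a ^ n • z).re = z.re + n * a := fun n ↦ by
    rw [translation_pow, translation_smul_re]
  simp only [UpperHalfPlane.coe_re, h]
  have h2 : Tendsto (fun n : ℕ ↦ (n : ℝ) * |a| - |z.re|) atTop atTop :=
    tendsto_atTop_add_const_right _ _
      (tendsto_natCast_atTop_atTop.atTop_mul_const (abs_pos.mpr ha))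
  refine tendsto_atTop_mono (fun n ↦ ?_) h2
  have h3 := abs_sub_abs_le_abs_sub ((n : ℝ) * a) (-z.re)
  rw [abs_neg, abs_mul, Nat.abs_cast, sub_neg_eq_add, add_comm _ z.re] at h3
  exact h3

lemma smul_infty_mem_boundary_of_dilation {N : PSL2R} {s : ℝ} (hs : s ≠ 0) (hs1 : 1 < s ^ 2)
    (hg : N * dilation s hs * N⁻¹ ∈ S.group) : N • (∞ : OnePoint ℝ) ∈ S.boundary := by
  refine S.smul_infty_mem_boundary hg fun z ↦ ?_
  refine tendsto_atTop_mono (fun n ↦ (le_abs_self _).trans (Complex.abs_im_le_norm _)) ?_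
  have h : ∀ n : ℕ, (dilation s hs ^ n • z).im = (s ^ 2) ^ n * z.im := fun n ↦ by
    have := apply_zpow_smul (f := UpperHalfPlane.im) (by positivity) (dilation_smul_im s hs) n z
    exact_mod_cast this
  simp only [UpperHalfPlane.coe_im, h]
  exact (tendsto_pow_atTop_atTop_of_one_lt hs1).atTop_mul_const z.im_pos

lemma fixedPointSet_subset_boundary {g : PSL2R} (hg : g ∈ S.group)
    (h2 : (fixedPointSet g).ncard = 2) : fixedPointSet g ⊆ S.boundary := by
  obtain ⟨N, s, hs, hs1, hgs, hP⟩ := exists_eq_conj_dilation h2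
  rw [hP, Set.pair_subset_iff]
  refine ⟨?_, S.smul_infty_mem_boundary_of_dilation hs hs1 (hgs ▸ hg)⟩
  rw [← inversion_smul_infty, ← mul_smul]
  refine S.smul_infty_mem_boundary_of_dilation hs hs1 ?_
  -- The other fixed point is attracting for `g⁻¹`.
  have h1 : inversion * dilation s hs * inversion⁻¹ = (dilation s hs)⁻¹ := by
    rw [inversion, dilation, mobius_inv, mobius_inv, mobius_mul, mobius_mul]
    apply mobius_congr <;> simp
  have h3 := S.group.inv_mem hg
  rw [hgs, conj_inv, ← h1] at h3
  convert h3 using 1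
  group

/-! ### The counting measure of a hyperbolic element -/

/-- The family of lifts of the closed geodesic of `g`, indexed by `G / ⟨g⟩`. -/
def liftFamily {g : S.group} (hg : (fixedPointSet (g : PSL2R)).ncard = 2)
    (c : S.group ⧸ Subgroup.zpowers g) : S.Pairs :=
  Quotient.out c • S.toPairs _ ⟨S.fixedPointSet_subset_boundary g.2 hg, hg⟩

variable {S}

/-- The chosen representative differs from `h` by a power of `g`, which fixes both endpoints. -/
lemma liftFamily_mk {g : S.group} (hg : (fixedPointSet (g : PSL2R)).ncard = 2) (h : S.group) :
    S.liftFamily hg (QuotientGroup.mk h) =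
      h • S.toPairs _ ⟨S.fixedPointSet_subset_boundary g.2 hg, hg⟩ := by
  obtain ⟨⟨k, m, rfl⟩, hk⟩ := QuotientGroup.mk_out_eq_mul (Subgroup.zpowers g) h
  have hk' : (Quotient.out (QuotientGroup.mk h : S.group ⧸ Subgroup.zpowers g)) = h * g ^ m := hk
  rw [liftFamily, hk', mul_smul]
  congr 1
  refine Subtype.ext ?_
  rw [coe_smul_pairs]
  exact (congrArg (fun k : PSL2R ↦ (fun p ↦ k • p) '' fixedPointSet (g : PSL2R))
    (Subgroup.coe_zpow _ g m)).trans (image_smul_fixedPointSet (g : PSL2R) m)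

lemma liftFamily_smul {g : S.group} (hg : (fixedPointSet (g : PSL2R)).ncard = 2) (h : S.group)
    (c : S.group ⧸ Subgroup.zpowers g) : S.liftFamily hg (h • c) = h • S.liftFamily hg c := by
  obtain ⟨k, rfl⟩ := QuotientGroup.mk_surjective c
  rw [MulAction.Quotient.smul_mk, liftFamily_mk, liftFamily_mk, smul_eq_mul, mul_smul]

lemma elementMeasure_eq {g : S.group} (hg : (fixedPointSet (g : PSL2R)).ncard = 2) :
    S.elementMeasure g = S.countingMeasure (S.liftFamily hg) := by
  rw [elementMeasure, dif_pos ⟨S.fixedPointSet_subset_boundary g.2 hg, hg⟩]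
  rfl

lemma exists_smul_mem_of_mem_geodesicLine_smul {h : S.group} {P : S.Pairs} {L : Set ℍ}
    (hP : (geodesicLine (h • P).1 ∩ L).Nonempty) :
    ∃ z ∈ geodesicLine P.1, (h : PSL2R) • z ∈ L := by
  obtain ⟨z, hz, hzL⟩ := hP
  refine ⟨(h : PSL2R)⁻¹ • z, ?_, by rwa [smul_inv_smul]⟩
  rwa [← smul_mem_geodesicLine_iff (h : PSL2R), smul_inv_smul]

/-- Changing the representative of a coset by a power of `g` moves the point to be sent into `L`
into a compact piece of the axis; proper discontinuity then applies. -/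
lemma isLocallyFiniteFamily_liftFamily {g : S.group}
    (hg : (fixedPointSet (g : PSL2R)).ncard = 2) : IsLocallyFiniteFamily (S.liftFamily hg) := by
  intro L hL
  obtain ⟨D, hD, hDg⟩ := exists_compact_zpow_smul_mem hg
  refine ((S.finite_smul_mem hD hL).image
    (QuotientGroup.mk : S.group → S.group ⧸ Subgroup.zpowers g)).subset fun c hc ↦ ?_
  obtain ⟨h, rfl⟩ := QuotientGroup.mk_surjective c
  rw [mem_ofPred_eq, liftFamily_mk] at hc
  obtain ⟨z, hz, hzL⟩ := exists_smul_mem_of_mem_geodesicLine_smul hc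
  obtain ⟨m, hm⟩ := hDg z hz
  refine ⟨h * (g ^ m)⁻¹, ⟨_, hm, ?_⟩, ?_⟩
  · rw [← mul_smul]
    simpa using hzL
  · rw [QuotientGroup.eq]
    exact ⟨m, by simp⟩

/-- Lower bounds for `intersectionNumber` depend on this, since `ncard` is `0` on infinite sets.
Every crossing can be slid along both axes into compact pieces. -/
lemma finite_intersections {g h : S.group} (hg : (fixedPointSet (g : PSL2R)).ncard = 2)
    (hh : (fixedPointSet (h : PSL2R)).ncard = 2) :
    ((fun k : S.group ↦ DoubleCoset.mk (Subgroup.zpowers g) (Subgroup.zpowers h) k) ''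
      {k | ∃ z : ℍ, axis g ∩ (fun w ↦ (k : PSL2R) • w) '' axis h = {z}}).Finite := by
  obtain ⟨D, hD, hDg⟩ := exists_compact_zpow_smul_mem hg
  obtain ⟨E, hE, hEh⟩ := exists_compact_zpow_smul_mem hh
  refine ((S.finite_smul_mem hE hD).image
    (fun k ↦ DoubleCoset.mk (Subgroup.zpowers g) (Subgroup.zpowers h) k)).subset ?_
  rintro _ ⟨k, ⟨z, hz⟩, rfl⟩
  obtain ⟨hzg, w, hw, hwz⟩ : z ∈ axis g ∩ (fun w ↦ (k : PSL2R) • w) '' axis h := by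
    rw [hz]; rfl
  simp only at hwz
  obtain ⟨m, hm⟩ := hDg z hzg
  obtain ⟨l, hl⟩ := hEh w hw
  refine ⟨g ^ m * k * (h ^ l)⁻¹, ⟨_, hl, ?_⟩, ?_⟩
  · rw [← mul_smul]
    simpa [mul_smul, hwz] using hm
  · rw [DoubleCoset.eq]
    exact ⟨(g ^ m)⁻¹, ⟨-m, by simp⟩, h ^ l, ⟨l, rfl⟩, by group⟩

end CuspedSurface

namespace CuspedSurface

/-! ### The products `αⁿ βⁿ` in normal form -/

/-- These are the roots of the fixed point equation `B x² - A B x - A = 0`. The discriminant of the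
monic form is `A B (A B + 4) / B²`, and `x₁` takes the square root with the sign of `A`. -/
lemma exists_roots {A B : ℝ} (hB : B ≠ 0) (hAB : 0 < A * B ∨ A * B < -4) :
    ∃ x₁ x₂ : ℝ, x₁ + x₂ = A ∧ B * (x₁ * x₂) = -A ∧ x₂ ^ 2 < x₁ ^ 2 := by
  have hA : A ≠ 0 := by rintro rfl; simp at hAB; linarith
  have hD : 0 < A ^ 2 + 4 * (A / B) := by
    have h1 : 0 < (A * B) ^ 2 + 4 * (A * B) := by rcases hAB with h | h <;> nlinarith
    have h2 : A ^ 2 + 4 * (A / B) = ((A * B) ^ 2 + 4 * (A * B)) / B ^ 2 := by field_simp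
    rw [h2]; positivity
  set r := √(A ^ 2 + 4 * (A / B)) with hr
  have hr0 : 0 < r := Real.sqrt_pos.mpr hD
  have hr2 : r ^ 2 = A ^ 2 + 4 * (A / B) := Real.sq_sqrt hD.le
  have hB' : B * (A / B) = A := by field_simp
  rcases hA.lt_or_gt with h | h
  · refine ⟨(A - r) / 2, (A + r) / 2, by ring, ?_, ?_⟩
    · linear_combination -B / 4 * hr2 - hB'
    · nlinarith
  · refine ⟨(A + r) / 2, (A - r) / 2, by ring, ?_, ?_⟩
    · linear_combination -B / 4 * hr2 - hB'
    · nlinarith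

lemma translation_mul_lowerTranslation (A B : ℝ) :
    translation A * lowerTranslation B = mobius (1 + A * B) A B 1 (by ring) := by
  rw [translation, lowerTranslation, mobius_mul]
  apply mobius_congr <;> ring

section

variable {A B x₁ x₂ : ℝ}

lemma root_ne_zero (hA : A ≠ 0) (h2 : B * (x₁ * x₂) = -A) : x₁ ≠ 0 ∧ x₂ ≠ 0 := by
  constructor <;> rintro rfl <;> apply hA <;> linarith

/-- The denominator of the product at its fixed points, in a form that is visibly nonzero and yields
the multiplier. -/
lemma mul_root_add_one (hA : A ≠ 0) (h1 : x₁ + x₂ = A) (h2 : B * (x₁ * x₂) = -A) :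
    B * x₁ + 1 = B * x₁ ^ 2 / A ∧ B * x₂ + 1 = B * x₂ ^ 2 / A := by
  constructor <;> field_simp
  · linear_combination -B * x₁ * h1 + h2
  · linear_combination -B * x₂ * h1 + h2

lemma fixedPointSet_mul (hA : A ≠ 0) (hB : B ≠ 0) (h1 : x₁ + x₂ = A)
    (h2 : B * (x₁ * x₂) = -A) :
    fixedPointSet (translation A * lowerTranslation B) =
      {(x₁ : OnePoint ℝ), (x₂ : OnePoint ℝ)} := by
  obtain ⟨hx1, hx2⟩ := root_ne_zero hA h2
  obtain ⟨h3, h4⟩ := mul_root_add_one hA h1 h2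
  rw [translation_mul_lowerTranslation]
  ext p
  rw [mem_fixedPointSet, Set.mem_insert_iff, Set.mem_singleton_iff]
  cases p with
  | infty => simp [mobius_smul_infty, hB, OnePoint.infty_ne_coe]
  | coe x =>
    rw [mobius_smul_coe]
    by_cases hx : B * x + 1 = 0
    · rw [if_pos hx]
      simp only [OnePoint.infty_ne_coe, OnePoint.coe_eq_coe, false_iff, not_or]
      constructor
      · rintro rfl
        rw [h3] at hx
        exact (by positivity : B * x ^ 2 / A ≠ 0) hx
      · rintro rfl
        rw [h4] at hx
        exact (by positivity : B * x ^ 2 / A ≠ 0) hx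
    · rw [if_neg hx, OnePoint.coe_eq_coe, OnePoint.coe_eq_coe, OnePoint.coe_eq_coe,
        div_eq_iff hx]
      constructor
      · intro h
        have : B * ((x - x₁) * (x - x₂)) = 0 := by linear_combination -h - B * x * h1 + h2
        rcases mul_eq_zero.mp ((mul_eq_zero.mp this).resolve_left hB) with h | h
        · left; linarith
        · right; linarith
      · rintro (rfl | rfl)
        · linear_combination -B * x * h1 + h2
        · linear_combination -B * x * h1 + h2

/-- The position of `z` relative to the two points `x₁, x₂` of the circle at infinity. -/
def distanceRatio (x₁ x₂ : ℝ) (z : ℍ) : ℝ :=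
  ((z.re - x₂) ^ 2 + z.im ^ 2) / ((z.re - x₁) ^ 2 + z.im ^ 2)

lemma distanceRatio_pos (x₁ x₂ : ℝ) (z : ℍ) : 0 < distanceRatio x₁ x₂ z := by
  have := z.im_pos
  unfold distanceRatio
  positivity

/-- For a fixed point `x`, `g z - x = (z - x) / ((B z + 1) (B x + 1))`. In the quotient the factor
`B z + 1` cancels, and `mul_root_add_one` evaluates the rest. -/
lemma distanceRatio_smul (hA : A ≠ 0) (hB : B ≠ 0) (h1 : x₁ + x₂ = A)
    (h2 : B * (x₁ * x₂) = -A) (z : ℍ) :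
    distanceRatio x₁ x₂ ((translation A * lowerTranslation B) • z) =
      (x₁ ^ 2 / x₂ ^ 2) ^ 2 * distanceRatio x₁ x₂ z := by
  obtain ⟨hx1, hx2⟩ := root_ne_zero hA h2
  obtain ⟨h3, h4⟩ := mul_root_add_one hA h1 h2
  have hdist : ∀ (x : ℝ) (w : ℍ), (w.re - x) ^ 2 + w.im ^ 2 = Complex.normSq ((w : ℂ) - x) := by
    intro x w
    rw [Complex.normSq_apply]
    simp
    ring
  have hden : ∀ w : ℍ, (B : ℂ) * w + 1 ≠ 0 := by
    intro w h
    have := congrArg Complex.im h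
    simp [hB, w.im_ne_zero] at this
  have key : ∀ x : ℝ, x ≠ 0 → B * x + 1 = B * x ^ 2 / A →
      Complex.normSq ((((translation A * lowerTranslation B) • z : ℍ) : ℂ) - x) =
      Complex.normSq ((z : ℂ) - x) / (Complex.normSq ((B : ℂ) * z + 1) * (B * x ^ 2 / A) ^ 2) := by
    intro x hx hBx
    have hBx' : B * x + 1 ≠ 0 := by rw [hBx]; positivity
    have hBC : (B : ℂ) * x + 1 ≠ 0 := by exact_mod_cast hBx'
    have hfix : (1 + A * B) * x + A = x * (B * x + 1) := by
      field_simp at hBx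
      linear_combination hBx
    have hfix' : (1 + (A : ℂ) * B) * x + A = x * (B * x + 1) := by exact_mod_cast hfix
    have h5 : (((translation A * lowerTranslation B) • z : ℍ) : ℂ) - x =
        ((z : ℂ) - x) / ((B * z + 1) * (B * x + 1 : ℝ)) := by
      have := hden z
      rw [translation_mul_lowerTranslation, coe_mobius_smul]
      push_cast
      field_simp
      linear_combination (B * z + 1) * hfix'
    rw [h5, Complex.normSq_div, Complex.normSq_mul, Complex.normSq_ofReal, ← hBx, sq]
  have hz1 : Complex.normSq ((z : ℂ) - x₁) ≠ 0 := by
    rw [← hdist]; have := z.im_pos; positivity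
  have hz0 : Complex.normSq ((B : ℂ) * z + 1) ≠ 0 := by
    rw [Ne, Complex.normSq_eq_zero]; exact hden z
  rw [distanceRatio, distanceRatio, hdist, hdist, hdist, hdist, key x₁ hx1 h3, key x₂ hx2 h4]
  generalize Complex.normSq ((B : ℂ) * z + 1) = u at hz0
  field_simp

end

/-! ### Estimates, uniform in `n`, for the part of the axis outside the cusps -/

/-- A low point on the half of a large semicircle next to `0` is close to `0`: where `X A ≥ 0`, the
bound `hX` gives `X² ≤ X A / 2`, and the circle equation leaves `X A / 2 ≤ Y² - c`; where `X A ≤ 0`,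
it gives `|X A| ≤ |c|` directly. -/
lemma abs_mul_le_of_line {A c X Y M : ℝ} (hline : X ^ 2 + Y ^ 2 - A * X = c)
    (hX : X * A ≤ A ^ 2 / 2) (hY0 : 0 ≤ Y) (hY : Y ≤ M) : |X| * |A| ≤ 2 * (M ^ 2 + |c|) := by
  have hM : Y ^ 2 ≤ M ^ 2 := by gcongr
  have hc1 := neg_abs_le c
  have hc2 := le_abs_self c
  rcases eq_or_ne A 0 with rfl | hA
  · simp only [abs_zero, mul_zero]
    positivity
  have hA2 : 0 < A ^ 2 := by positivity
  rw [← abs_mul]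
  rcases le_total 0 (X * A) with h | h
  · rw [abs_of_nonneg h]
    have : X ^ 2 ≤ X * A / 2 := by
      have h3 : (X * A) * (X * A) ≤ (A ^ 2 / 2) * (X * A) := mul_le_mul_of_nonneg_right hX h
      have h4 : A ^ 2 * X ^ 2 ≤ A ^ 2 * (X * A / 2) := by linarith
      exact le_of_mul_le_mul_left h4 hA2
    nlinarith
  · rw [abs_of_nonpos h]
    nlinarith [sq_nonneg X]

/-- Write `Q = X² + Y²`. Squaring `|X| ≤ C Q` and `Y ≤ M Q` gives `Q ≤ (C² + M²) Q²`, so `Q` is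
bounded below. Multiplying `f1` and `f2` gives `X² n² ≤ C² Q`, so for `n ≥ 2 C` at least half of `Q`
comes from `Y²`. -/
lemma bounds_of_abs_mul_le {C M X Y n : ℝ} (hC0 : 0 < C) (hY : 0 < Y) (hn1 : 2 * C ≤ n)
    (hn0 : 1 ≤ n) (f1 : |X| * n ≤ C) (f2 : |X| * n ≤ C * (X ^ 2 + Y ^ 2))
    (hM : Y ≤ M * (X ^ 2 + Y ^ 2)) : |X| ≤ C ∧ √(1 / (2 * (C ^ 2 + M ^ 2))) ≤ Y := by
  have hXn : |X| ≤ |X| * n := le_mul_of_one_le_right (abs_nonneg X) hn0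
  refine ⟨hXn.trans f1, ?_⟩
  have g2 := hXn.trans f2
  obtain ⟨Q, hQ⟩ : ∃ Q, Q = X ^ 2 + Y ^ 2 := ⟨_, rfl⟩
  rw [← hQ] at f2 g2 hM
  have hQ0 : 0 < Q := by rw [hQ]; positivity
  have hX2 : X ^ 2 ≤ (C * Q) ^ 2 := by rw [← sq_abs]; gcongr
  have hY2 : Y ^ 2 ≤ (M * Q) ^ 2 := by gcongr
  have hQ1 : 1 ≤ (C ^ 2 + M ^ 2) * Q := by
    have : Q * 1 ≤ Q * ((C ^ 2 + M ^ 2) * Q) := by linarith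
    exact le_of_mul_le_mul_left this hQ0
  have hXQ : X ^ 2 ≤ Q / 2 := by
    have k1 : X ^ 2 * n ^ 2 ≤ C ^ 2 * Q := by
      have := mul_le_mul f1 f2 (by positivity) hC0.le
      calc X ^ 2 * n ^ 2 = |X| * n * (|X| * n) := by rw [← sq_abs X]; ring
        _ ≤ _ := by linarith
    have k2 : (2 * C) ^ 2 ≤ n ^ 2 := by gcongr
    have k3 := (mul_le_mul_of_nonneg_left k2 (sq_nonneg X)).trans k1
    have k4 : 0 < C ^ 2 := by positivity
    have k5 : C ^ 2 * (4 * X ^ 2) ≤ C ^ 2 * Q := by linarith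
    linarith [le_of_mul_le_mul_left k5 k4]
  refine Real.sqrt_le_iff.mpr ⟨hY.le, ?_⟩
  rw [div_le_iff₀ (by positivity)]
  calc 1 ≤ (C ^ 2 + M ^ 2) * Q := hQ1
    _ = Q / 2 * (2 * (C ^ 2 + M ^ 2)) := by ring
    _ ≤ Y ^ 2 * (2 * (C ^ 2 + M ^ 2)) :=
      mul_le_mul_of_nonneg_right (by linarith) (by positivity)

/-- The last two conditions before the conclusion cut out the arc from the top of the semicircle to
the point that `-1 / z` makes the top, that is, between the deepest points of the excursions into
the cusps `∞` and `0`. `abs_mul_le_of_line` is applied once in each cusp. -/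
lemma exists_box_of_half {a b : ℝ} (ha : a ≠ 0) (hb : b ≠ 0) (M : ℝ) :
    ∃ C δ : ℝ, 0 < δ ∧ ∃ n₀ : ℕ, ∀ n ≥ n₀, ∀ x₁ x₂ X Y : ℝ, x₁ + x₂ = n * a →
      b * (x₁ * x₂) = -a → x₂ ^ 2 < x₁ ^ 2 → 0 < Y →
      X ^ 2 + Y ^ 2 - (x₁ + x₂) * X + x₁ * x₂ = 0 → Y ≤ M → Y / (X ^ 2 + Y ^ 2) ≤ M →
      (X - x₂) ^ 2 + Y ^ 2 ≤ (X - x₁) ^ 2 + Y ^ 2 →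
      x₂ ^ 2 * ((X - x₁) ^ 2 + Y ^ 2) ≤ x₁ ^ 2 * ((X - x₂) ^ 2 + Y ^ 2) →
      |X| ≤ C ∧ δ ≤ Y ∧ Y ≤ M := by
  set C := 2 * (M ^ 2 + |a / b|) / |a| + 2 * (M ^ 2 + |b / a|) / |b| with hC
  have hC1 : 2 * (M ^ 2 + |a / b|) / |a| ≤ C := by
    rw [hC]; exact le_add_of_nonneg_right (by positivity)
  have hC2 : 2 * (M ^ 2 + |b / a|) / |b| ≤ C := by
    rw [hC]; exact le_add_of_nonneg_left (by positivity)
  have hC0 : 0 < C := by positivity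
  refine ⟨C, √(1 / (2 * (C ^ 2 + M ^ 2))), Real.sqrt_pos.mpr (by positivity),
    ⌈2 * C⌉₊ + 1, fun n hn x₁ x₂ X Y h1 h2 h3 hY hline hM hM' hτ1 hτ2 ↦ ?_⟩
  have hn1 : (2 * C : ℝ) ≤ n := (Nat.le_ceil _).trans (by exact_mod_cast (Nat.le_succ _).trans hn)
  have hn0 : (1 : ℝ) ≤ n := by exact_mod_cast (Nat.le_add_left 1 _).trans hn
  have hnpos : (0 : ℝ) < n := by linarith
  set Q := X ^ 2 + Y ^ 2 with hQ
  have hQ0 : 0 < Q := by positivity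
  have hA : (0 : ℝ) < (x₁ - x₂) * (n * a) := by rw [← h1]; linarith
  have hx12 : x₁ * x₂ = -(a / b) := by field_simp; linarith
  -- the side of the middle of the line
  have e1 : X * (n * a) ≤ (n * a) ^ 2 / 2 := by
    have h4 : 0 ≤ (x₁ - x₂) * (n * a - 2 * X) := by rw [← h1]; linarith
    have h5 : 0 ≤ (n * a) * (n * a - 2 * X) := by
      by_contra! hlt
      have h6 : x₁ - x₂ ≠ 0 := by intro h; simp [h] at hA
      have h7 : 0 < (x₁ - x₂) ^ 2 := by positivity
      nlinarith [mul_nonneg hA.le h4]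
    linarith
  -- The same in the coordinate `-1 / z`: the endpoints `-1 / x₁, -1 / x₂` have sum `n * b` and
  -- product `-b / a`, and `hτ2` says that the image is nearer to `-1 / x₁`.
  have e2 : -X / Q * (n * b) ≤ (n * b) ^ 2 / 2 := by
    have h4 : 0 ≤ (x₁ - x₂) * (n * a * Q - 2 * X * (x₁ * x₂)) := by rw [← h1]; linarith
    have h5 : 0 ≤ (n * a) * (n * a * Q - 2 * X * (x₁ * x₂)) := by
      by_contra! hlt
      have h6 : x₁ - x₂ ≠ 0 := by intro h; simp [h] at hA
      have h7 : 0 < (x₁ - x₂) ^ 2 := by positivity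
      nlinarith [mul_nonneg hA.le h4]
    have h6 : 0 ≤ n * b * (n * b * Q + 2 * X) := by
      have : n * b * (n * b * Q + 2 * X) =
          (n * a) * (n * a * Q - 2 * X * (x₁ * x₂)) * (b ^ 2 / a ^ 2) := by
        rw [hx12]; field_simp; ring
      rw [this]; positivity
    rw [div_mul_eq_mul_div, div_le_iff₀ hQ0]
    linarith
  have f1 : |X| * n ≤ C := by
    have h4 := abs_mul_le_of_line (A := n * a) (c := a / b) (by rw [← h1]; linarith) e1 hY.le hM
    rw [abs_mul, Nat.abs_cast, ← mul_assoc] at h4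
    exact ((le_div_iff₀ (abs_pos.mpr ha)).mpr h4).trans hC1
  have f2 : |X| * n ≤ C * Q := by
    have h4 := abs_mul_le_of_line (X := -X / Q) (Y := Y / Q) (A := n * b) (c := b / a) (M := M)
      (by
        have : Q = n * a * X + a / b := by rw [← h1]; linarith
        field_simp
        rw [this]
        field_simp at this ⊢
        linear_combination this) e2 (by positivity) hM'
    rw [abs_mul, Nat.abs_cast, ← mul_assoc] at h4
    have h5 := ((le_div_iff₀ (abs_pos.mpr hb)).mpr h4).trans hC2
    rw [abs_div, abs_neg, abs_of_pos hQ0, div_mul_eq_mul_div, div_le_iff₀ hQ0] at h5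
    exact h5
  rw [div_le_iff₀ hQ0] at hM'
  obtain ⟨g1, g2⟩ := bounds_of_abs_mul_le hC0 hY hn1 hn0 f1 f2 hM'
  exact ⟨g1, g2, hM⟩

/-- Every point of the axis of `αⁿ βⁿ` that is not close to a cusp can be moved to a fixed compact
set by `(αⁿ βⁿ)ᵐ` or by `α⁻ⁿ (αⁿ βⁿ)ᵐ`. -/
lemma exists_box_of_axis {a b : ℝ} (ha : a ≠ 0) (hb : b ≠ 0) (M : ℝ) :
    ∃ D : Set ℍ, IsCompact D ∧ ∃ n₀ : ℕ, ∀ n ≥ n₀, ∀ x₁ x₂ : ℝ, x₁ + x₂ = n * a →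
      b * (x₁ * x₂) = -a → x₂ ^ 2 < x₁ ^ 2 → ∀ g : PSL2R,
      g = translation (n * a) * lowerTranslation (n * b) → ∀ z ∈ axis g,
      (∀ m : ℤ, ∀ w : ℍ, w = g ^ m • z ∨ w = (translation (n * a))⁻¹ • g ^ m • z →
        w.im ≤ M ∧ w.im / (w.re ^ 2 + w.im ^ 2) ≤ M) →
      ∃ m : ℤ, g ^ m • z ∈ D ∨ (translation (n * a))⁻¹ • g ^ m • z ∈ D := by
  obtain ⟨C, δ, hδ, n₀, hn₀⟩ := exists_box_of_half ha hb M
  refine ⟨box C δ M, isCompact_box C M hδ, n₀ + 1, fun n hn x₁ x₂ h1 h2 h3 g hg z hz hM ↦ ?_⟩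
  have hn' : (n : ℝ) ≠ 0 := by
    have : n ≠ 0 := by omega
    exact_mod_cast this
  have hA : (n : ℝ) * a ≠ 0 := mul_ne_zero hn' ha
  have hB : (n : ℝ) * b ≠ 0 := mul_ne_zero hn' hb
  have h2' : n * b * (x₁ * x₂) = -(n * a) := by linear_combination n * h2
  obtain ⟨hx1, hx2⟩ := root_ne_zero hA h2'
  have hx12 : x₁ ≠ x₂ := by rintro rfl; exact lt_irrefl _ h3
  have hx1' : 0 < x₁ ^ 2 := by positivity
  have hx2' : 0 < x₂ ^ 2 := by positivity
  set ρ := x₁ ^ 2 / x₂ ^ 2 with hρ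
  have hρ1 : 1 < ρ := (one_lt_div hx2').mpr h3
  have hρ0 : 0 < ρ := by linarith
  -- `g` multiplies the ratio by `ρ ^ 2`; the extra factor `ρ` places the chosen period at `[1 / ρ,
  -- ρ]`, symmetric about the top of the axis, where the ratio is `1`.
  obtain ⟨m, hm1, hm2⟩ := exists_mem_Ico_zpow (x := distanceRatio x₁ x₂ z * ρ) (y := ρ ^ 2)
    (mul_pos (distanceRatio_pos _ _ _) hρ0) (one_lt_pow₀ hρ1 two_ne_zero)
  have hR := apply_zpow_smul (f := distanceRatio x₁ x₂) (g := g) (R := ρ ^ 2) (by positivity)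
    (fun w ↦ by rw [hg]; exact distanceRatio_smul hA hB h1 h2' w) (-m) z
  set w := g ^ (-m) • z with hw
  have hpos : 0 < (ρ ^ 2) ^ m := by positivity
  have hτ1 : 1 ≤ distanceRatio x₁ x₂ w * ρ := by
    rw [hR, zpow_neg, inv_mul_eq_div, div_mul_eq_mul_div, le_div_iff₀ hpos, one_mul]
    exact hm1
  have hτ2 : distanceRatio x₁ x₂ w ≤ ρ := by
    rw [zpow_add₀ (by positivity), zpow_one, sq ρ, ← mul_assoc] at hm2
    have := lt_of_mul_lt_mul_right hm2 hρ0.le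
    rw [hR, zpow_neg, inv_mul_eq_div, div_le_iff₀ hpos, mul_comm, sq]
    exact this.le
  have hwax : w ∈ axis g := zpow_smul_mem_axis hz _
  rw [axis, hg, fixedPointSet_mul hA hB h1 h2', mem_geodesicLine_coe hx12] at hwax
  have him := w.im_pos
  have hd1 : 0 < (w.re - x₁) ^ 2 + w.im ^ 2 := by positivity
  have hd2 : 0 < (w.re - x₂) ^ 2 + w.im ^ 2 := by positivity
  rw [distanceRatio, hρ, div_mul_div_comm, le_div_iff₀ (by positivity)] at hτ1
  rw [distanceRatio, hρ, div_le_div_iff₀ (by positivity) (by positivity)] at hτ2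
  refine ⟨-m, ?_⟩
  rcases le_total ((w.re - x₂) ^ 2 + w.im ^ 2) ((w.re - x₁) ^ 2 + w.im ^ 2) with hle | hle
  · left
    obtain ⟨hM1, hM2⟩ := hM (-m) w (Or.inl rfl)
    exact hn₀ n (by omega) x₁ x₂ w.re w.im h1 h2 h3 him hwax hM1 hM2 hle (by linarith)
  · right
    obtain ⟨hM1, hM2⟩ := hM (-m) _ (Or.inr rfl)
    rw [translation_inv, translation_smul_re, translation_smul_im, ← hw, ← h1] at hM2
    rw [translation_inv, translation_smul_im, ← hw] at hM1
    -- The reflection in the vertical line through the top exchanges the two arcs. It differs from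
    -- the translation by `-(n * a)` only by `x ↦ -x`, which preserves the box.
    have := hn₀ n (by omega) x₁ x₂ (x₁ + x₂ - w.re) w.im h1 h2 h3 him
      (by linear_combination hwax) hM1 (by convert hM2 using 3; ring)
      (by linarith) (by linarith)
    rw [← hw]
    simp only [box, mem_ofPred_eq, translation_inv, translation_smul_re, translation_smul_im]
    rw [← h1, ← abs_neg]
    convert this using 3
    ring

end CuspedSurface

namespace CuspedSurface

/-! ### Hyperbolicity of `αⁿ βⁿ` -/

lemma isHyperbolic_mul {A B : ℝ} (hAB : 0 < A * B ∨ A * B < -4) :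
    IsHyperbolic (translation A * lowerTranslation B) := by
  rw [translation_mul_lowerTranslation, isHyperbolic_mobius_iff]
  rcases hAB with h | h <;> nlinarith

/-- The trace `2 + A B` lies strictly between `-2` and `2`, so the fixed point equation has complex
conjugate roots. -/
lemma exists_smul_eq_self {A B : ℝ} (h0 : A * B < 0) (h4 : -4 < A * B) :
    ∃ z : ℍ, (translation A * lowerTranslation B) • z = z := by
  have hB : B ≠ 0 := by rintro rfl; simp at h0
  have hD : 0 < -(A ^ 2 + 4 * (A / B)) := by
    have h2 : -(A ^ 2 + 4 * (A / B)) = -((A * B) * (A * B + 4)) / B ^ 2 := by field_simp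
    rw [h2]
    exact div_pos (by nlinarith) (by positivity)
  set r := √(-(A ^ 2 + 4 * (A / B))) with hr
  have hr0 : 0 < r := Real.sqrt_pos.mpr hD
  have hr2 : B * r ^ 2 = -(A ^ 2 * B + 4 * A) := by
    rw [hr, Real.sq_sqrt hD.le]; field_simp
  refine ⟨⟨⟨A / 2, r / 2⟩, by simpa using hr0⟩, ?_⟩
  have hden : (B : ℂ) * (⟨A / 2, r / 2⟩ : ℂ) + 1 ≠ 0 := by
    intro h
    have := congrArg Complex.im h
    simp [hB, hr0.ne'] at this
  ext1
  rw [translation_mul_lowerTranslation, coe_mobius_smul]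
  push_cast
  rw [div_eq_iff hden]
  apply Complex.ext
  · simp
    linear_combination hr2 / 4
  · simp
    ring

/-! ### Currents -/

variable {S : CuspedSurface}

/-- Invariant and locally finite measures. -/
def IsCurrent (μ : Measure S.Pairs) : Prop :=
  IsFiniteMeasureOnCompacts μ ∧ SMulInvariantMeasure S.group S.Pairs μ

lemma isCurrent_elementMeasure (g : S.group) : IsCurrent (S.elementMeasure g) := by
  by_cases hg : (fixedPointSet (g : PSL2R)).ncard = 2
  · rw [elementMeasure_eq hg]
    exact ⟨isFiniteMeasureOnCompacts_countingMeasure (isLocallyFiniteFamily_liftFamily hg),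
      smulInvariantMeasure_countingMeasure (liftFamily_smul hg)⟩
  · rw [elementMeasure, dif_neg fun h ↦ hg h.2]
    exact ⟨⟨fun K _ ↦ by simp⟩, ⟨fun _ _ _ ↦ by simp⟩⟩

lemma IsCurrent.two_smul {μ : Measure S.Pairs} (hμ : IsCurrent μ) : IsCurrent (2 • μ) := by
  obtain ⟨h1, h2⟩ := hμ
  rw [two_nsmul]
  refine ⟨⟨fun K hK ↦ ?_⟩, ⟨fun c s hs ↦ ?_⟩⟩
  · rw [Measure.add_apply]
    exact ENNReal.add_lt_top.mpr ⟨hK.measure_lt_top, hK.measure_lt_top⟩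
  · rw [Measure.add_apply, Measure.add_apply, h2.measure_preimage_smul c hs]

lemma IsCurrent.integral_two_smul {μ : Measure S.Pairs} (hμ : IsCurrent μ) (f : C_c(S.Pairs, ℝ)) :
    ∫ P, f P ∂(2 • μ) = 2 * ∫ P, f P ∂μ := by
  have := hμ.1
  have hint : Integrable (fun P ↦ f P) μ :=
    f.continuous.integrable_of_hasCompactSupport f.hasCompactSupport
  rw [two_nsmul, integral_add_measure hint hint, two_mul]

/-- Used with an index type `κ` that does not vary with `n`, so that limits can be taken termwise.
-/
lemma integral_countingMeasure_eq_sum {ι κ : Type*} [Fintype κ] {φ : ι → S.Pairs}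
    (hφ : IsLocallyFiniteFamily φ) (f : C_c(S.Pairs, ℝ)) {ψ : κ → ι} (hψ : Function.Injective ψ)
    (hf : ∀ c, φ c ∈ tsupport f → c ∈ range ψ) :
    ∫ P, f P ∂(S.countingMeasure φ) = ∑ k, f (φ (ψ k)) := by
  rw [integral_countingMeasure hφ, ← hψ.tsum_eq (f := fun c ↦ f (φ c)), tsum_fintype]
  exact fun c hc ↦ hf c (subset_tsupport _ hc)

lemma tendsto_current {ι : Type*} {l : Filter ι} {η : ι → S.Current} {μ : S.Current}
    (h : ∀ f : C_c(S.Pairs, ℝ), Tendsto (fun i ↦ ∫ P, f P ∂(η i).1) l (𝓝 (∫ P, f P ∂μ.1))) :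
    Tendsto η l (𝓝 μ) := by
  rw [nhds_induced, tendsto_comap_iff]
  exact tendsto_pi_nhds.mpr h

lemma tendsto_pairs_of_tendsto {N : PSL2R} {P : ℕ → S.Pairs} {Q : S.Pairs} {u v : ℕ → ℝ}
    (hP : ∀ᶠ n in atTop, (P n).1 = {N • (v n : OnePoint ℝ), N • (u n : OnePoint ℝ)})
    (hQ : Q.1 = {N • (∞ : OnePoint ℝ), N • ((0 : ℝ) : OnePoint ℝ)})
    (hu : Tendsto u atTop (𝓝 0)) (hv : Tendsto (fun n ↦ |v n|) atTop atTop) :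
    Tendsto P atTop (𝓝 Q) := by
  refine S.tendsto_pairs hP hQ ?_ ?_
  · refine ((continuous_const_smul N).tendsto _).comp (OnePoint.tendsto_coe_infty.comp ?_)
    rw [coclosedCompact_eq_cocompact, ← Metric.cobounded_eq_cocompact,
      ← tendsto_norm_atTop_iff_cobounded]
    exact hv
  · exact ((continuous_const_smul N).tendsto _).comp ((OnePoint.continuous_coe.tendsto _).comp hu)

/-! ### A pair of cusps -/

section CuspPair

variable {N : PSL2R} {a b : ℝ} {α β : S.group}

/-- In the excluded range `α β` would fix a point of `ℍ` without being trivial, since in these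
coordinates it moves `∞`. -/
lemma mul_pos_or_le (ha : a ≠ 0) (hb : b ≠ 0) (hα : (α : PSL2R) = N * translation a * N⁻¹)
    (hβ : (β : PSL2R) = N * lowerTranslation b * N⁻¹) : 0 < a * b ∨ a * b ≤ -4 := by
  by_contra! hcon
  have h0 : a * b < 0 := lt_of_le_of_ne hcon.1 (mul_ne_zero ha hb)
  obtain ⟨z, hz⟩ := exists_smul_eq_self h0 hcon.2
  have hαβ : ((α * β : S.group) : PSL2R) = N * (translation a * lowerTranslation b) * N⁻¹ := by
    rw [Subgroup.coe_mul, hα, hβ]; group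
  have h1 := S.free _ (α * β).2 (N • z) (by
    rw [hαβ, mul_smul, inv_smul_smul, mul_smul, hz])
  rw [hαβ, conj_eq_one_iff] at h1
  have h2 : (translation a * lowerTranslation b) • (∞ : OnePoint ℝ) = ∞ := by rw [h1, one_smul]
  rw [translation_mul_lowerTranslation, mobius_smul_infty, if_neg hb] at h2
  exact OnePoint.coe_ne_infty _ h2

lemma coe_pow_mul_pow (hα : (α : PSL2R) = N * translation a * N⁻¹)
    (hβ : (β : PSL2R) = N * lowerTranslation b * N⁻¹) (n : ℕ) :
    ((α ^ n * β ^ n : S.group) : PSL2R) =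
      N * (translation (n * a) * lowerTranslation (n * b)) * N⁻¹ := by
  rw [Subgroup.coe_mul, Subgroup.coe_pow, Subgroup.coe_pow, hα, hβ, conj_pow, conj_pow,
    translation_pow, lowerTranslation_pow]
  group

/-- The boundary case `a b = -4`, with `α β` parabolic, is possible; hence `n ≥ 2`, where `n² a b ≤
-16`. -/
lemma mul_pos_or_lt (ha : a ≠ 0) (hb : b ≠ 0) (hα : (α : PSL2R) = N * translation a * N⁻¹)
    (hβ : (β : PSL2R) = N * lowerTranslation b * N⁻¹) {n : ℕ} (hn : 2 ≤ n) :
    0 < n * a * (n * b) ∨ n * a * (n * b) < -4 := by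
  have hn' : (2 : ℝ) ≤ n := by exact_mod_cast hn
  have h1 : (n : ℝ) * a * (n * b) = n ^ 2 * (a * b) := by ring
  have h2 : (4 : ℝ) ≤ n ^ 2 := by nlinarith
  rw [h1]
  rcases mul_pos_or_le ha hb hα hβ with h | h
  · left; positivity
  · right; nlinarith

lemma isHyperbolic_pow_mul_pow (ha : a ≠ 0) (hb : b ≠ 0)
    (hα : (α : PSL2R) = N * translation a * N⁻¹)
    (hβ : (β : PSL2R) = N * lowerTranslation b * N⁻¹) {n : ℕ} (hn : 2 ≤ n) :
    IsHyperbolic ((α ^ n * β ^ n : S.group) : PSL2R) := by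
  rw [coe_pow_mul_pow hα hβ, isHyperbolic_conj_iff]
  exact isHyperbolic_mul (mul_pos_or_lt ha hb hα hβ hn)

lemma fixedPointSet_pow_mul_pow (ha : a ≠ 0) (hb : b ≠ 0)
    (hα : (α : PSL2R) = N * translation a * N⁻¹)
    (hβ : (β : PSL2R) = N * lowerTranslation b * N⁻¹) {n : ℕ} (hn : n ≠ 0) {x₁ x₂ : ℝ}
    (h1 : x₁ + x₂ = n * a) (h2 : n * b * (x₁ * x₂) = -(n * a)) :
    fixedPointSet ((α ^ n * β ^ n : S.group) : PSL2R) =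
      {N • (x₁ : OnePoint ℝ), N • (x₂ : OnePoint ℝ)} := by
  have hn' : (n : ℝ) ≠ 0 := by exact_mod_cast hn
  rw [coe_pow_mul_pow hα hβ, fixedPointSet_conj,
    fixedPointSet_mul (mul_ne_zero hn' ha) (mul_ne_zero hn' hb) h1 h2, image_pair]

/-- The product of the fixed points does not depend on `n` while their sum grows linearly: the
larger one satisfies `|x₁| ≥ n |a| / 2`, and `|x₂| = |a / b| / |x₁|`. -/
lemma exists_fixedPoints (ha : a ≠ 0) (hb : b ≠ 0)
    (hα : (α : PSL2R) = N * translation a * N⁻¹)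
    (hβ : (β : PSL2R) = N * lowerTranslation b * N⁻¹) :
    ∃ x₁ x₂ : ℕ → ℝ, (∀ n, 2 ≤ n → x₁ n + x₂ n = n * a ∧ b * (x₁ n * x₂ n) = -a ∧
      x₂ n ^ 2 < x₁ n ^ 2 ∧ fixedPointSet ((α ^ n * β ^ n : S.group) : PSL2R) =
      {N • (x₁ n : OnePoint ℝ), N • (x₂ n : OnePoint ℝ)}) ∧
      Tendsto (fun n ↦ |x₁ n|) atTop atTop ∧ Tendsto x₂ atTop (𝓝 0) := by
  have key : ∀ n : ℕ, ∃ x₁ x₂ : ℝ, 2 ≤ n → x₁ + x₂ = n * a ∧ b * (x₁ * x₂) = -a ∧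
      x₂ ^ 2 < x₁ ^ 2 ∧ fixedPointSet ((α ^ n * β ^ n : S.group) : PSL2R) =
      {N • (x₁ : OnePoint ℝ), N • (x₂ : OnePoint ℝ)} := by
    intro n
    by_cases hn : 2 ≤ n
    · have hn0 : n ≠ 0 := by omega
      have hn' : (n : ℝ) ≠ 0 := by exact_mod_cast hn0
      obtain ⟨x₁, x₂, h1, h2, h3⟩ := exists_roots (mul_ne_zero hn' hb)
        (mul_pos_or_lt ha hb hα hβ hn)
      refine ⟨x₁, x₂, fun _ ↦ ⟨h1, ?_, h3, fixedPointSet_pow_mul_pow ha hb hα hβ hn0 h1 h2⟩⟩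
      refine mul_left_cancel₀ hn' ?_
      linear_combination h2
    · exact ⟨0, 0, fun h ↦ absurd h hn⟩
  choose x₁ x₂ hx using key
  have hle : ∀ n : ℕ, 2 ≤ n → (n : ℝ) * (|a| / 2) ≤ |x₁ n| := by
    intro n hn
    obtain ⟨h1, -, h3, -⟩ := hx n hn
    have h4 : |x₂ n| < |x₁ n| := sq_lt_sq.mp h3
    have h5 := abs_add_le (x₁ n) (x₂ n)
    rw [h1, abs_mul, Nat.abs_cast] at h5
    linarith
  have hlim : Tendsto (fun n ↦ |x₁ n|) atTop atTop :=
    tendsto_atTop_mono' _ ((eventually_ge_atTop 2).mono hle)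
      (tendsto_natCast_atTop_atTop.atTop_mul_const (half_pos (abs_pos.mpr ha)))
  refine ⟨x₁, x₂, hx, hlim, squeeze_zero_norm' ?_
    (hlim.const_div_atTop (|a| / |b|))⟩
  filter_upwards [eventually_ge_atTop 2] with n hn
  obtain ⟨-, h2, h3, -⟩ := hx n hn
  have h4 : 0 < |x₁ n| := (abs_nonneg _).trans_lt (sq_lt_sq.mp h3)
  have h5 := congrArg abs h2
  rw [abs_mul, abs_mul, abs_neg] at h5
  rw [Real.norm_eq_abs, le_div_iff₀ h4, le_div_iff₀ (abs_pos.mpr hb)]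
  linarith

variable {P : S.Pairs}

lemma ncard_fixedPointSet {x₁ x₂ : ℝ} {g : PSL2R} (h3 : x₂ ^ 2 < x₁ ^ 2)
    (hP : fixedPointSet g = {N • (x₁ : OnePoint ℝ), N • (x₂ : OnePoint ℝ)}) :
    (fixedPointSet g).ncard = 2 := by
  have : x₁ ≠ x₂ := by rintro rfl; exact lt_irrefl _ h3
  rw [hP, Set.ncard_pair]
  simpa using this

/-- The compact sets that control both cusps at once. -/
lemma exists_thick_bound (ha : a ≠ 0) (hb : b ≠ 0)
    (hα : (α : PSL2R) = N * translation a * N⁻¹)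
    (hβ : (β : PSL2R) = N * lowerTranslation b * N⁻¹) {L : Set ℍ} (hL : IsCompact L) :
    ∃ M, 0 < M ∧ ∀ h ∈ S.group, ∀ w : ℍ, h • N • w ∈ L →
      w.im ≤ M ∧ w.im / (w.re ^ 2 + w.im ^ 2) ≤ M := by
  obtain ⟨M₁, hM₁⟩ := S.exists_im_le ha (hα ▸ α.2) hL
  obtain ⟨M₂, hM₂⟩ := S.exists_im_le_lower hb (hβ ▸ β.2) hL
  refine ⟨max 1 (max M₁ M₂), by positivity, fun h hh w hw ↦ ?_⟩
  have h1 := hM₁ h hh _ hw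
  have h2 := hM₂ h hh _ hw
  rw [inv_smul_smul] at h1 h2
  exact ⟨h1.trans ((le_max_left _ _).trans (le_max_right _ _)),
    h2.trans ((le_max_right _ _).trans (le_max_right _ _))⟩

/-- At height `y` on the line from `0` to `∞` the bounds in the two cusps are `y ≤ M` and `1 / y ≤
M`, which leaves a compact segment. -/
lemma exists_finite_of_smul_pair (ha : a ≠ 0) (hb : b ≠ 0)
    (hα : (α : PSL2R) = N * translation a * N⁻¹)
    (hβ : (β : PSL2R) = N * lowerTranslation b * N⁻¹)
    (hP : P.1 = {N • (∞ : OnePoint ℝ), N • ((0 : ℝ) : OnePoint ℝ)}) {L : Set ℍ}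
    (hL : IsCompact L) : {h : S.group | (geodesicLine (h • P).1 ∩ L).Nonempty}.Finite := by
  obtain ⟨M, hM0, hM⟩ := exists_thick_bound ha hb hα hβ hL
  refine (S.finite_smul_mem (K := (fun z ↦ N • z) '' box 0 (1 / M) M)
    ((isCompact_box 0 M (by positivity)).image (continuous_const_smul N)) hL).subset fun h hh ↦ ?_
  obtain ⟨z, hz, hzL⟩ := exists_smul_mem_of_mem_geodesicLine_smul hh
  rw [hP, Set.pair_comm, mem_geodesicLine_smul] at hz
  obtain ⟨h1, h2⟩ := hM h h.2 (N⁻¹ • z) (by rwa [smul_inv_smul])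
  have him := (N⁻¹ • z).im_pos
  refine ⟨z, ⟨N⁻¹ • z, ⟨by simp [hz], ?_, h1⟩, smul_inv_smul _ _⟩, hzL⟩
  rw [hz, div_le_iff₀ (by positivity)] at h2
  rw [div_le_iff₀ hM0]
  have h3 : (N⁻¹ • z).im * 1 ≤ (N⁻¹ • z).im * ((N⁻¹ • z).im * M) := by linarith
  exact le_of_mul_le_mul_left h3 him

/-- The point is that `F` does not depend on `n`: it consists of the elements that carry a point of
the uniform compact set of `exists_box_of_axis` into `L`. -/
lemma exists_finite_of_smul_axis (ha : a ≠ 0) (hb : b ≠ 0)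
    (hα : (α : PSL2R) = N * translation a * N⁻¹)
    (hβ : (β : PSL2R) = N * lowerTranslation b * N⁻¹) {L : Set ℍ} (hL : IsCompact L) :
    ∃ F : Set S.group, F.Finite ∧ ∃ n₀ : ℕ, ∀ n ≥ n₀, 2 ≤ n → ∀ h : S.group, ∀ z ∈
      axis ((α ^ n * β ^ n : S.group) : PSL2R), (h : PSL2R) • z ∈ L →
      ∃ m : ℤ, h * (α ^ n * β ^ n) ^ m ∈ F ∨ h * (α ^ n * β ^ n) ^ m * α ^ n ∈ F := by
  obtain ⟨M, hM0, hM⟩ := exists_thick_bound ha hb hα hβ hL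
  obtain ⟨D, hD, n₀, hn₀⟩ := exists_box_of_axis ha hb M
  obtain ⟨x₁, x₂, hx, -, -⟩ := exists_fixedPoints ha hb hα hβ
  refine ⟨_, S.finite_smul_mem (hD.image (continuous_const_smul N)) hL, n₀,
    fun n hn hn2 h z hz hzL ↦ ?_⟩
  obtain ⟨h1, h2, h3, -⟩ := hx n hn2
  have hg := coe_pow_mul_pow hα hβ n
  set g := translation (n * a) * lowerTranslation (n * b) with hgdef
  set G : S.group := α ^ n * β ^ n with hG
  have hpow : ∀ m : ℤ, ((G ^ m : S.group) : PSL2R) = N * g ^ m * N⁻¹ := fun m ↦ by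
    rw [Subgroup.coe_zpow, hg, conj_zpow]
  have hαn : ((α ^ n : S.group) : PSL2R) = N * translation (n * a) * N⁻¹ := by
    rw [Subgroup.coe_pow, hα, conj_pow, translation_pow]
  have e1 : ∀ m : ℤ, ((h * G ^ (-m) : S.group) : PSL2R) • N • g ^ m • N⁻¹ • z =
      (h : PSL2R) • z := by
    intro m
    rw [Subgroup.coe_mul, hpow]
    simp only [← mul_smul]
    congr 1
    group
  have e2 : ∀ m : ℤ, ((h * G ^ (-m) * α ^ n : S.group) : PSL2R) • N •
      (translation (n * a))⁻¹ • g ^ m • N⁻¹ • z = (h : PSL2R) • z := by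
    intro m
    rw [Subgroup.coe_mul, Subgroup.coe_mul, hpow, hαn]
    simp only [← mul_smul]
    congr 1
    group
  have hz' : N⁻¹ • z ∈ axis g := by
    rw [axis, hg, fixedPointSet_conj] at hz
    rwa [← smul_inv_smul N z, smul_mem_geodesicLine_iff] at hz
  obtain ⟨m, hm⟩ := hn₀ n hn (x₁ n) (x₂ n) h1 h2 h3 g hgdef (N⁻¹ • z) hz' (by
    rintro m w (rfl | rfl)
    · exact hM _ (h * G ^ (-m)).2 _ (by rw [e1]; exact hzL)
    · exact hM _ (h * G ^ (-m) * α ^ n).2 _ (by rw [e2]; exact hzL))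
  refine ⟨-m, hm.imp (fun hm ↦ ⟨_, ⟨_, hm, rfl⟩, ?_⟩) (fun hm ↦ ⟨_, ⟨_, hm, rfl⟩, ?_⟩)⟩
  · simp only
    rw [e1]; exact hzL
  · simp only
    rw [e2]; exact hzL

end CuspPair

end CuspedSurface

namespace CuspedSurface

/-! ### Convergence of the counting measures -/

section

variable {S : CuspedSurface} {N : PSL2R} {a b : ℝ} {α β : S.group} {P : S.Pairs}

lemma smul_pair_injective (ha : a ≠ 0) (hα : (α : PSL2R) = N * translation a * N⁻¹)
    (hP : P.1 = {N • (∞ : OnePoint ℝ), N • ((0 : ℝ) : OnePoint ℝ)}) :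
    Function.Injective fun h : S.group ↦ h • P := by
  intro h k hhk
  have h1 : (h⁻¹ * k) • P = P := by
    rw [mul_smul, inv_smul_eq_iff]; exact hhk.symm
  have h2 := congrArg Subtype.val h1
  rw [coe_smul_pairs, hP] at h2
  have h3 := S.eq_one_of_smul_pair ha (hα ▸ α.2) (h⁻¹ * k).2 h2
  exact inv_mul_eq_one.mp (Subtype.ext h3)

lemma isLocallyFiniteFamily_ofQuotientStabilizer (ha : a ≠ 0) (hb : b ≠ 0)
    (hα : (α : PSL2R) = N * translation a * N⁻¹)
    (hβ : (β : PSL2R) = N * lowerTranslation b * N⁻¹)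
    (hP : P.1 = {N • (∞ : OnePoint ℝ), N • ((0 : ℝ) : OnePoint ℝ)}) :
    IsLocallyFiniteFamily (MulAction.ofQuotientStabilizer S.group P) := by
  intro L hL
  refine ((exists_finite_of_smul_pair ha hb hα hβ hP hL).image
    (QuotientGroup.mk : S.group → S.group ⧸ MulAction.stabilizer S.group P)).subset fun c hc ↦ ?_
  obtain ⟨h, rfl⟩ := QuotientGroup.mk_surjective c
  exact ⟨h, hc, rfl⟩

lemma isCurrent_pairMeasure (ha : a ≠ 0) (hb : b ≠ 0)
    (hα : (α : PSL2R) = N * translation a * N⁻¹)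
    (hβ : (β : PSL2R) = N * lowerTranslation b * N⁻¹)
    (hP : P.1 = {N • (∞ : OnePoint ℝ), N • ((0 : ℝ) : OnePoint ℝ)}) :
    IsCurrent (S.pairMeasure P) :=
  ⟨isFiniteMeasureOnCompacts_countingMeasure
      (isLocallyFiniteFamily_ofQuotientStabilizer ha hb hα hβ hP),
    smulInvariantMeasure_countingMeasure (MulAction.ofQuotientStabilizer_smul S.group P)⟩

/-- For large `n` the integral is a sum over the fixed finite set `F × Bool`, where the Boolean
selects one of the two lifts near the pair of cusps. Twice the limiting integral is a sum over the
same set, in which both values of the Boolean give the same term. -/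
theorem tendsto_integral_elementMeasure (ha : a ≠ 0) (hb : b ≠ 0)
    (hα : (α : PSL2R) = N * translation a * N⁻¹)
    (hβ : (β : PSL2R) = N * lowerTranslation b * N⁻¹)
    (hP : P.1 = {N • (∞ : OnePoint ℝ), N • ((0 : ℝ) : OnePoint ℝ)}) (f : C_c(S.Pairs, ℝ)) :
    Tendsto (fun n : ℕ ↦ ∫ R, f R ∂(S.elementMeasure (α ^ n * β ^ n))) atTop
      (𝓝 (2 * ∫ R, f R ∂(S.pairMeasure P))) := by
  obtain ⟨U, -, hKU, L, hL, hUL⟩ := S.exists_isOpen_geodesicLine_inter f.hasCompactSupport.isCompact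
  have hinj := smul_pair_injective ha hα hP
  have hF₁ := exists_finite_of_smul_pair ha hb hα hβ hP hL
  obtain ⟨F₂, hF₂, n₀, hn₀⟩ := exists_finite_of_smul_axis ha hb hα hβ hL
  set F₁ := {h : S.group | (geodesicLine (h • P).1 ∩ L).Nonempty} with hF₁def
  obtain ⟨F, hF⟩ : ∃ F : Finset S.group, (F : Set S.group) = F₁ ∪ F₂ :=
    (hF₁.union hF₂).exists_finset_coe
  have hF₁' : ∀ h ∈ F₁, h ∈ F := fun h hh ↦ by rw [← Finset.mem_coe, hF]; exact Or.inl hh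
  have hF₂' : ∀ h ∈ F₂, h ∈ F := fun h hh ↦ by rw [← Finset.mem_coe, hF]; exact Or.inr hh
  obtain ⟨x₁, x₂, hx, hx₁, hx₂⟩ := exists_fixedPoints ha hb hα hβ
  have hcard : ∀ n, 2 ≤ n → (fixedPointSet ((α ^ n * β ^ n : S.group) : PSL2R)).ncard = 2 :=
    fun n hn ↦ ncard_fixedPointSet (hx n hn).2.2.1 (hx n hn).2.2.2
  -- the two lifts that converge to the given pair
  set R : ℕ → S.Pairs := fun n ↦ if hn : 2 ≤ n then
    S.toPairs _ ⟨S.fixedPointSet_subset_boundary (α ^ n * β ^ n).2 (hcard n hn), hcard n hn⟩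
    else P with hRdef
  have hR' : ∀ n (hn : 2 ≤ n), R n = S.toPairs _
      ⟨S.fixedPointSet_subset_boundary (α ^ n * β ^ n).2 (hcard n hn), hcard n hn⟩ :=
    fun n hn ↦ dif_pos hn
  have hR : ∀ n, 2 ≤ n → (R n).1 = {N • (x₁ n : OnePoint ℝ), N • (x₂ n : OnePoint ℝ)} := by
    intro n hn
    rw [hR' n hn]
    exact (hx n hn).2.2.2
  set Q : ℕ → S.Pairs := fun n ↦ (α ^ n)⁻¹ • R n with hQdef
  have hQ : ∀ n, 2 ≤ n →
      (Q n).1 = {N • ((-x₁ n : ℝ) : OnePoint ℝ), N • ((-x₂ n : ℝ) : OnePoint ℝ)} := by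
    intro n hn
    have h1 : (((α ^ n)⁻¹ : S.group) : PSL2R) = N * translation (-(n * a)) * N⁻¹ := by
      rw [Subgroup.coe_inv, Subgroup.coe_pow, hα, conj_pow, translation_pow, conj_inv,
        translation_inv]
    have h2 := (hx n hn).1
    rw [hQdef, coe_smul_pairs, hR n hn, image_pair, h1, mul_smul, mul_smul, mul_smul, mul_smul,
      inv_smul_smul, inv_smul_smul, translation_smul_coe, translation_smul_coe, Set.pair_comm]
    -- `x₁ - n a = -x₂` and `x₂ - n a = -x₁`: the endpoints exchange roles.
    congr 4 <;> linarith
  have hRlim : Tendsto R atTop (𝓝 P) :=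
    tendsto_pairs_of_tendsto ((eventually_ge_atTop 2).mono hR) hP hx₂ hx₁
  have hQlim : Tendsto Q atTop (𝓝 P) :=
    tendsto_pairs_of_tendsto ((eventually_ge_atTop 2).mono hQ) hP (by simpa using hx₂.neg)
      (by simpa using hx₁)
  have hRQ : ∀ n, 2 ≤ n → R n ≠ Q n := by
    intro n hn h
    obtain ⟨h1, -, h3, -⟩ := hx n hn
    have h4 : N • (x₁ n : OnePoint ℝ) ∈ (Q n).1 := by
      rw [← h, hR n hn]; exact Set.mem_insert _ _
    rw [hQ n hn] at h4
    rcases h4 with h4 | h4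
    · have h5 := OnePoint.coe_eq_coe.mp (smul_left_cancel N h4)
      have h6 : x₁ n = 0 := by linarith
      rw [h6] at h3
      nlinarith [sq_nonneg (x₂ n)]
    · have h5 := OnePoint.coe_eq_coe.mp (smul_left_cancel N h4)
      rw [h5] at h3
      nlinarith
  set W : ℕ → F × Bool → S.Pairs := fun n k ↦ (k.1 : S.group) • cond k.2 (R n) (Q n) with hW
  have hWlim : ∀ k, Tendsto (fun n ↦ W n k) atTop (𝓝 ((k.1 : S.group) • P)) := by
    rintro ⟨h, _ | _⟩
    · exact ((continuous_const_smul (h : S.group)).tendsto _).comp hQlim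
    · exact ((continuous_const_smul (h : S.group)).tendsto _).comp hRlim
  -- No lift may be counted twice. Different group elements give different limits `h • P`, hence
  -- different pairs eventually; for the same element, `R n ≠ Q n`.
  have hWinj : ∀ᶠ n in atTop, Function.Injective (W n) := by
    have key : ∀ k l : F × Bool, ∀ᶠ n in atTop, W n k = W n l → k = l := by
      intro k l
      by_cases hkl : k.1 = l.1
      · filter_upwards [eventually_ge_atTop 2] with n hn hWn
        refine Prod.ext hkl ?_
        simp only [hW, hkl] at hWn
        have h1 := smul_left_cancel _ hWn
        rcases hk : k.2 <;> rcases hl : l.2 <;> rw [hk, hl] at h1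
        · exact absurd h1.symm (hRQ n hn)
        · exact absurd h1 (hRQ n hn)
      · have hne : (k.1 : S.group) • P ≠ (l.1 : S.group) • P := fun h ↦
          hkl (Subtype.ext (hinj h))
        filter_upwards [((hWlim k).prodMk_nhds (hWlim l)).eventually
          (isClosed_diagonal.isOpen_compl.mem_nhds hne)] with n hn hWn
        exact absurd hWn hn
    have := eventually_all.mpr fun k ↦ eventually_all.mpr (key k)
    exact this.mono fun n hn k l ↦ hn k l
  have hsum : ∀ᶠ n in atTop, ∑ k, f (W n k) = ∫ R, f R ∂(S.elementMeasure (α ^ n * β ^ n)) := by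
    filter_upwards [hWinj, eventually_ge_atTop 2, eventually_ge_atTop n₀] with n hn hn2 hnn₀
    set g := α ^ n * β ^ n with hg
    set ψ : F × Bool → S.group ⧸ Subgroup.zpowers g := fun k ↦
      QuotientGroup.mk ((k.1 : S.group) * cond k.2 1 (α ^ n)⁻¹) with hψ
    have hlift : ∀ h : S.group, S.liftFamily (hcard n hn2) (QuotientGroup.mk h) = h • R n :=
      fun h ↦ by rw [liftFamily_mk, hR' n hn2]
    have hψW : ∀ k, S.liftFamily (hcard n hn2) (ψ k) = W n k := by
      rintro ⟨h, _ | _⟩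
      · rw [hψ, hlift, mul_smul]; rfl
      · rw [hψ, hlift, mul_smul, cond_true, one_smul]; rfl
    have hψinj : Function.Injective ψ := by
      intro k l hkl
      apply hn
      rw [← hψW, ← hψW, hkl]
    rw [elementMeasure_eq (hcard n hn2), integral_countingMeasure_eq_sum
      (isLocallyFiniteFamily_liftFamily (hcard n hn2)) f hψinj]
    · exact Finset.sum_congr rfl fun k _ ↦ by rw [hψW]
    · intro c hc
      obtain ⟨h, rfl⟩ := QuotientGroup.mk_surjective c
      rw [hlift] at hc
      obtain ⟨z, hz, hzL⟩ := exists_smul_mem_of_mem_geodesicLine_smul (hUL _ (hKU hc))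
      rw [hR' n hn2] at hz
      -- The two alternatives are the lifts near `R n` and near `Q n`; the power of `g` disappears
      -- in the coset.
      obtain ⟨m, hm | hm⟩ := hn₀ n hnn₀ hn2 h z hz hzL
      · refine ⟨(⟨_, hF₂' _ hm⟩, true), ?_⟩
        simp only [hψ, cond_true, mul_one]
        rw [eq_comm, QuotientGroup.eq]
        exact ⟨m, by simp⟩
      · refine ⟨(⟨_, hF₂' _ hm⟩, false), ?_⟩
        simp only [hψ, cond_false, mul_inv_cancel_right]
        rw [eq_comm, QuotientGroup.eq]
        exact ⟨m, by simp⟩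
  have hpair : 2 * ∫ R, f R ∂(S.pairMeasure P) = ∑ k : F × Bool, f ((k.1 : S.group) • P) := by
    set ψ : F → S.group ⧸ MulAction.stabilizer S.group P := fun h ↦
      QuotientGroup.mk (h : S.group) with hψ
    have hψP : ∀ h : F, MulAction.ofQuotientStabilizer S.group P (ψ h) = (h : S.group) • P :=
      fun h ↦ rfl
    have h1 : ∫ R, f R ∂(S.pairMeasure P) = ∑ h : F, f ((h : S.group) • P) := by
      refine (integral_countingMeasure_eq_sum
        (isLocallyFiniteFamily_ofQuotientStabilizer ha hb hα hβ hP) f (ψ := ψ) ?_ ?_).trans ?_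
      · intro h k hhk
        refine Subtype.ext (hinj ?_)
        simp only
        rw [← hψP, ← hψP, hhk]
      · intro c hc
        obtain ⟨h, rfl⟩ := QuotientGroup.mk_surjective c
        exact ⟨⟨h, hF₁' h (hUL _ (hKU hc))⟩, rfl⟩
      · rfl
    rw [h1, Fintype.sum_prod_type, Finset.mul_sum]
    refine Finset.sum_congr rfl fun h _ ↦ ?_
    simp [two_mul]
  rw [hpair]
  refine Tendsto.congr' hsum (tendsto_finsetSum _ fun k _ ↦ ?_)
  exact (f.continuous.tendsto _).comp (hWlim k)

theorem exists_tendsto_current (ha : a ≠ 0) (hb : b ≠ 0)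
    (hα : (α : PSL2R) = N * translation a * N⁻¹)
    (hβ : (β : PSL2R) = N * lowerTranslation b * N⁻¹) :
    ∃ (η : ℕ → S.Current) (P : S.Pairs) (μ : S.Current),
      (∀ n, (η n).1 = S.elementMeasure (α ^ n * β ^ n)) ∧
      P.1 = {N • (∞ : OnePoint ℝ), N • ((0 : ℝ) : OnePoint ℝ)} ∧
      μ.1 = 2 • S.pairMeasure P ∧ Tendsto η atTop (𝓝 μ) := by
  have h1 := S.smul_infty_mem_boundary_of_translation ha (hα ▸ α.2)
  have h2 : N • ((0 : ℝ) : OnePoint ℝ) ∈ S.boundary := by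
    rw [← inversion_smul_infty, ← mul_smul]
    refine S.smul_infty_mem_boundary_of_translation (neg_ne_zero.mpr hb) ?_
    have := β.2
    rw [hβ, lowerTranslation_eq_conj] at this
    convert this using 1
    group
  have h3 : N • (∞ : OnePoint ℝ) ≠ N • ((0 : ℝ) : OnePoint ℝ) := fun h ↦
    OnePoint.infty_ne_coe _ (smul_left_cancel N h)
  set P : S.Pairs := S.toPairs {N • (∞ : OnePoint ℝ), N • ((0 : ℝ) : OnePoint ℝ)}
    ⟨Set.pair_subset h1 h2, Set.ncard_pair h3⟩
  have hP : P.1 = {N • (∞ : OnePoint ℝ), N • ((0 : ℝ) : OnePoint ℝ)} := rfl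
  have hcur := isCurrent_pairMeasure ha hb hα hβ hP
  refine ⟨fun n ↦ ⟨_, isCurrent_elementMeasure (α ^ n * β ^ n)⟩, P, ⟨_, hcur.two_smul⟩,
    fun n ↦ rfl, hP, rfl, tendsto_current fun f ↦ ?_⟩
  simp only
  rw [hcur.integral_two_smul]
  exact tendsto_integral_elementMeasure ha hb hα hβ hP f

end

end CuspedSurface

namespace CuspedSurface

/-! ### Two cusps with different fixed points -/

instance instSMulInvariantMeasureUpperHalfPlane :
    SMulInvariantMeasure PSL2R ℍ (volume : Measure ℍ) where
  measure_preimage_smul g s hs := by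
    obtain ⟨A, rfl⟩ := QuotientGroup.mk_surjective g
    exact measure_preimage_smul volume (Matrix.SpecialLinearGroup.mapGL ℝ A) s

/-- The strip `x ≤ re z < y`. -/
def strip (x y : ℝ) : Set ℍ := {z | x ≤ z.re ∧ z.re < y}

lemma measurableSet_strip (x y : ℝ) : MeasurableSet (strip x y) :=
  (measurableSet_le measurable_const UpperHalfPlane.continuous_re.measurable).inter
    (measurableSet_lt UpperHalfPlane.continuous_re.measurable measurable_const)

lemma volume_strip_ne_zero {x y : ℝ} (hxy : x < y) : volume (strip x y) ≠ 0 := by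
  rw [UpperHalfPlane.volume_eq_lintegral]
  have hm : MeasurableSet (UpperHalfPlane.coe '' strip x y) :=
    UpperHalfPlane.measurableEmbedding_coe.measurableSet_image.mpr (measurableSet_strip x y)
  rw [Ne, lintegral_eq_zero_iff (by fun_prop), Filter.EventuallyEq, ae_restrict_iff' hm]
  intro h
  have h0 : volume (UpperHalfPlane.coe '' strip x y) = 0 := by
    refine measure_mono_null ?_ h
    rintro _ ⟨z, hz, rfl⟩ hcon
    have := hcon ⟨z, hz, rfl⟩
    simp [z.im_ne_zero] at this
  have hopen : IsOpen (UpperHalfPlane.coe '' {z : ℍ | x < z.re ∧ z.re < y}) :=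
    UpperHalfPlane.isOpenEmbedding_coe.isOpenMap _
      ((isOpen_lt continuous_const UpperHalfPlane.continuous_re).inter
        (isOpen_lt UpperHalfPlane.continuous_re continuous_const))
  refine (hopen.measure_pos volume ?_).ne' (measure_mono_null (image_mono fun z hz ↦ ?_) h0)
  · exact ⟨_, ⟨⟨(x + y) / 2, 1⟩, one_pos⟩, by
      constructor <;> simp only [UpperHalfPlane.re] <;> linarith, rfl⟩
  · exact ⟨hz.1.le, hz.2⟩

/-- A dilation shows that doubling the width keeps the area, a translation that it doubles the area;
a finite area would be zero. -/
lemma volume_strip_eq_top {δ : ℝ} (hδ : 0 < δ) : volume (strip 0 δ) = ⊤ := by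
  by_contra hne
  have hs : √2 ≠ 0 := by positivity
  have h1 : volume (strip 0 (2 * δ)) = volume (strip 0 δ) := by
    rw [← measure_preimage_smul volume (dilation (√2) hs) (strip 0 (2 * δ))]
    congr 1
    ext z
    simp only [strip, mem_preimage, mem_ofPred_eq, dilation_smul_re,
      Real.sq_sqrt zero_le_two]
    constructor <;> rintro ⟨h1, h2⟩ <;> constructor <;> linarith
  have h2 : volume (strip δ (2 * δ)) = volume (strip 0 δ) := by
    rw [← measure_preimage_smul volume (translation δ) (strip δ (2 * δ))]
    congr 1
    ext z
    simp only [strip, mem_preimage, mem_ofPred_eq, translation_smul_re]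
    constructor <;> rintro ⟨h1, h2⟩ <;> constructor <;> linarith
  have h3 : strip 0 (2 * δ) = strip 0 δ ∪ strip δ (2 * δ) := by
    ext z
    simp only [strip, mem_union, mem_ofPred_eq]
    constructor
    · rintro ⟨h1, h2⟩
      rcases lt_or_ge z.re δ with h | h
      · exact Or.inl ⟨h1, h⟩
      · exact Or.inr ⟨h, h2⟩
    · rintro (⟨h1, h2⟩ | ⟨h1, h2⟩) <;> constructor <;> linarith
  rw [h3, measure_union _ (measurableSet_strip _ _), h2] at h1
  · have h4 : volume (strip 0 δ) + volume (strip 0 δ) = volume (strip 0 δ) + 0 := by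
      rw [h1, add_zero]
    exact volume_strip_ne_zero hδ ((ENNReal.add_right_inj hne).mp h4)
  · rw [Set.disjoint_left]
    rintro z ⟨-, h1⟩ ⟨h2, -⟩
    linarith

/-! ### Existence of a second cusp from finite area -/

variable (S : CuspedSurface)

lemma countable_group : Countable S.group := by
  have h : (univ : Set S.group) = ⋃ n : ℕ, {g : S.group | ∃ z ∈ ({I} : Set ℍ),
      (g : PSL2R) • z ∈ Metric.closedBall I (n : ℝ)} := by
    refine (Set.eq_univ_of_forall fun g ↦ mem_iUnion.mpr ?_).symm
    obtain ⟨n, hn⟩ := exists_nat_ge (dist ((g : PSL2R) • I) I)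
    exact ⟨n, I, rfl, hn⟩
  rw [← Set.countable_univ_iff, h]
  exact Set.countable_iUnion fun n ↦
    (S.finite_smul_mem isCompact_singleton (isCompact_closedBall _ _)).countable

lemma exists_parabolic_fixedPoint {g : PSL2R} (hg : IsParabolic g) :
    ∃ p : OnePoint ℝ, g • p = p := by
  obtain ⟨A, rfl, hA⟩ := hg
  have h := Matrix.GeneralLinearGroup.IsParabolic.smul_eq_self_iff
    (g := Matrix.SpecialLinearGroup.toGL A) hA (c := _) |>.mpr rfl
  exact ⟨_, h⟩

/-- Otherwise the group would consist of translations. Without hyperbolic elements the cover has no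
frontier, so it is `ℍ`; but translation lengths are bounded below, and a strip of that width embeds
in the quotient with infinite area. -/
lemma exists_not_fixed {N : PSL2R} {a : ℝ} (ha : a ≠ 0)
    (hα : N * translation a * N⁻¹ ∈ S.group) :
    ∃ g ∈ S.group, g • N • (∞ : OnePoint ℝ) ≠ N • (∞ : OnePoint ℝ) := by
  by_contra! hfix
  have htrans : ∀ g ∈ S.group, ∃ c : ℝ, g = N * translation c * N⁻¹ := by
    intro g hg
    obtain ⟨s, c, hs, hB⟩ := exists_dilation_mul_translation_of_smul_infty (g := N⁻¹ * g * N)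
      (by rw [mul_smul, mul_smul, hfix g hg, inv_smul_smul])
    have hgB : g = N * mobius s c 0 s⁻¹ (by field_simp; ring) * N⁻¹ := by rw [← hB]; group
    have hs1 := S.sq_eq_one_of_conj_mem ha hα hs (hgB ▸ hg)
    rcases mul_self_eq_one_iff.mp ((sq s).symm.trans hs1) with rfl | rfl
    · exact ⟨c, by rw [hgB]; congr 2; exact mobius_congr rfl rfl rfl (by norm_num)⟩
    · refine ⟨-c, ?_⟩
      rw [hgB, translation, ← mobius_neg]
      congr 2
      exact mobius_congr (by norm_num) rfl (by norm_num) (by norm_num)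
  have hcover : S.cover = univ := by
    have hclopen : IsClopen S.cover := by
      rw [isClopen_iff_frontier_eq_empty, Set.eq_empty_iff_forall_notMem]
      intro z hz
      obtain ⟨g, hg, hhyp, -⟩ := S.cover_frontier z hz
      obtain ⟨c, rfl⟩ := htrans g hg
      rw [isHyperbolic_conj_iff, translation, isHyperbolic_mobius_iff] at hhyp
      norm_num at hhyp
    exact hclopen.eq_univ (S.cover_interior.mono interior_subset)
  obtain ⟨ε, hε, hεS⟩ := S.exists_displacement (isCompact_singleton (x := N • I))
  have hc : 0 < 2 * (Real.cosh ε - 1) := by linarith [Real.one_lt_cosh.mpr hε.ne']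
  have hdisp : ∀ c : ℝ, N * translation c * N⁻¹ ∈ S.group → c ≠ 0 →
      2 * (Real.cosh ε - 1) ≤ c ^ 2 := by
    intro c hc hc0
    have h1 := hεS _ hc (fun h ↦ translation_ne_one hc0 (conj_eq_one_iff.mp h)) _ rfl
    rw [mul_smul, inv_smul_smul, mul_smul, dist_smul] at h1
    have h2 : Real.cosh ε ≤ Real.cosh (dist I (translation c • I)) :=
      Real.cosh_le_cosh.mpr (by rwa [abs_of_pos hε, abs_of_nonneg dist_nonneg])
    rw [UpperHalfPlane.cosh_dist, translation_smul_im, dist_comm, Complex.dist_eq, translation,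
      coe_mobius_smul] at h2
    simp at h2
    linarith
  set δ := √(2 * (Real.cosh ε - 1)) with hδ
  have hδ0 : 0 < δ := Real.sqrt_pos.mpr hc
  obtain ⟨F, hF, hFfin⟩ := S.finite_area
  rw [hcover, inter_univ] at hFfin
  have := S.countable_group
  -- No nontrivial translation is shorter than `δ`, so the translates of the half-open strip are
  -- disjoint and its area is at most that of a fundamental domain.
  have hle := hF.measure_le_of_pairwise_disjoint (t := (fun z ↦ N⁻¹ • z) ⁻¹' strip 0 δ)
    ((continuous_const_smul N⁻¹).measurable (measurableSet_strip 0 δ)).nullMeasurableSet ?_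
  · rw [measure_preimage_smul, volume_strip_eq_top hδ0] at hle
    exact absurd (hle.trans_lt hFfin) (lt_irrefl _)
  · intro g h hgh
    refine Disjoint.aedisjoint (Disjoint.mono inter_subset_left inter_subset_left ?_)
    rw [Set.disjoint_left]
    rintro _ ⟨z, hz, rfl⟩ ⟨w, hw, hwz⟩
    apply hgh
    obtain ⟨c, hc⟩ := htrans _ (h⁻¹ * g).2
    have hwz' : w = N • translation c • N⁻¹ • z := by
      rw [← mul_smul, ← mul_smul, ← hc, Subgroup.coe_mul, mul_smul, Subgroup.coe_inv,
        eq_inv_smul_iff]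
      exact hwz
    have hre : (N⁻¹ • w).re = (N⁻¹ • z).re + c := by
      rw [hwz', inv_smul_smul, translation_smul_re]
    obtain ⟨h1, h2⟩ := hz
    obtain ⟨h3, h4⟩ := hw
    simp only at h1 h2 h3 h4
    rw [hre] at h3 h4
    have hc0 : c = 0 := by
      by_contra hc0
      have h5 := Real.sqrt_le_sqrt (hdisp c (hc ▸ (h⁻¹ * g).2) hc0)
      rw [Real.sqrt_sq_eq_abs, ← hδ, le_abs] at h5
      rcases h5 with h5 | h5 <;> linarith
    have h6 : (h⁻¹ * g : S.group) = 1 := by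
      refine Subtype.ext ?_
      rw [hc, hc0, Subgroup.coe_one, conj_eq_one_iff]
      exact mobius_one
    exact (inv_mul_eq_one.mp h6).symm

/-- A parabolic `γ` and its conjugate by an element that moves the fixed point of `γ`. -/
lemma exists_two_cusps : ∃ (N : PSL2R) (a b : ℝ) (α β : S.group), a ≠ 0 ∧ b ≠ 0 ∧
    (α : PSL2R) = N * translation a * N⁻¹ ∧ (β : PSL2R) = N * lowerTranslation b * N⁻¹ := by
  obtain ⟨γ, hγ, hγp⟩ := S.has_cusp
  obtain ⟨p, hp⟩ := exists_parabolic_fixedPoint hγp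
  obtain ⟨N₀, rfl⟩ := exists_smul_infty p
  obtain ⟨c, hc, hγc⟩ := exists_eq_conj_translation hγp hp
  obtain ⟨g, hg, hgp⟩ := S.exists_not_fixed hc (hγc ▸ hγ)
  obtain ⟨N, hN, hN0⟩ := exists_smul_infty_smul_zero hgp.symm
  obtain ⟨a, ha, hα⟩ := exists_eq_conj_translation (N := N) hγp (by rw [hN, hp])
  obtain ⟨b, hb, hβ⟩ := exists_eq_conj_lowerTranslation (N := N)
    ((isParabolic_conj_iff g γ).mpr hγp) (by
      rw [hN0, mul_smul, mul_smul, inv_smul_smul, hp])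
  exact ⟨N, a, b, ⟨γ, hγ⟩, ⟨g * γ * g⁻¹, S.group.mul_mem (S.group.mul_mem hg hγ)
    (S.group.inv_mem hg)⟩, ha, hb, hα, hβ⟩

end CuspedSurface

namespace CuspedSurface

/-! ### Self-intersections of `αⁿ βⁿ` -/

/-- The trace of `A K A K⁻¹` depends only on the double coset `⟨A⟩ K ⟨A⟩` in `PSL(2, ℝ)`. -/
lemma trace_eq_of_coe_eq {A K K' : SL(2, ℝ)} {s t : ℤ}
    (h : (K' : PSL2R) = (A : PSL2R) ^ s * K * (A : PSL2R) ^ t) :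
    (A * K' * A * K'⁻¹).1.trace = (A * K * A * K⁻¹).1.trace := by
  have h1 : ((A ^ s * K * A ^ t : SL(2, ℝ)) : PSL2R) = K' := h.symm
  rw [QuotientGroup.eq] at h1
  obtain ⟨c, hc⟩ : ∃ c, c = (A ^ s * K * A ^ t)⁻¹ * K' := ⟨_, rfl⟩
  rw [← hc] at h1
  have hcA : A * c = c * A := Subgroup.mem_center_iff.mp h1 A
  have hK : K' = A ^ s * K * A ^ t * c := by rw [hc]; group
  have h2 : A * K' * A * K'⁻¹ = A ^ s * (A * K * A * K⁻¹) * (A ^ s)⁻¹ := by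
    rw [hK]
    have h3 : A ^ s * K * A ^ t * c * A = A ^ s * K * A * A ^ t * c := by
      rw [mul_assoc _ c A, ← hcA]
      group
    rw [show A * (A ^ s * K * A ^ t * c) * A = A * (A ^ s * K * A ^ t * c * A) by group, h3]
    group
  rw [h2, Matrix.SpecialLinearGroup.coe_mul, Matrix.SpecialLinearGroup.coe_mul,
    Matrix.trace_mul_comm, ← mul_assoc, ← Matrix.SpecialLinearGroup.coe_mul, inv_mul_cancel,
    Matrix.SpecialLinearGroup.coe_one, one_mul]

/-- For `K = translation u` the invariant trace equals `(1 + A B)² + 2 A B + 1 - B² u²`, so it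
determines `u²`. -/
lemma sq_eq_sq_of_translation_eq {A B u v : ℝ} (hB : B ≠ 0) {s t : ℤ}
    (h : translation v = (translation A * lowerTranslation B) ^ s * translation u *
      (translation A * lowerTranslation B) ^ t) : u ^ 2 = v ^ 2 := by
  rw [translation_mul_lowerTranslation] at h
  have h1 := trace_eq_of_coe_eq (A := slOf (1 + A * B) A B 1 (by ring))
    (K := slOf 1 u 0 1 (by ring)) (K' := slOf 1 v 0 1 (by ring)) h
  simp only [Matrix.SpecialLinearGroup.coe_mul, Matrix.SpecialLinearGroup.coe_inv] at h1
  simp only [slOf, Matrix.adjugate_fin_two_of, Matrix.mul_fin_two, Matrix.trace_fin_two_of] at h1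
  have h2 : B ^ 2 * (u ^ 2 - v ^ 2) = 0 := by linear_combination h1
  have h3 := (mul_eq_zero.mp h2).resolve_left (by positivity)
  linarith

section

variable {S : CuspedSurface} {N : PSL2R} {a b : ℝ} {α β : S.group}

lemma doubleCoset_injOn (ha : a ≠ 0) (hb : b ≠ 0)
    (hα : (α : PSL2R) = N * translation a * N⁻¹)
    (hβ : (β : PSL2R) = N * lowerTranslation b * N⁻¹) {n : ℕ} (hn : n ≠ 0) :
    Function.Injective fun j : ℕ ↦ DoubleCoset.mk (Subgroup.zpowers (α ^ n * β ^ n))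
      (Subgroup.zpowers (α ^ n * β ^ n)) (α ^ j) := by
  intro j k hjk
  have hn' : (n : ℝ) ≠ 0 := by exact_mod_cast hn
  obtain ⟨_, ⟨s, rfl⟩, _, ⟨t, rfl⟩, hst⟩ := (DoubleCoset.eq _ _ _ _).mp hjk
  have h1 := congrArg (Subtype.val : S.group → PSL2R) hst
  simp only [Subgroup.coe_mul (H := S.group), Subgroup.coe_zpow] at h1
  rw [← Subgroup.coe_mul, coe_pow_mul_pow hα hβ, conj_zpow, conj_zpow, Subgroup.coe_pow,
    Subgroup.coe_pow, hα, conj_pow, conj_pow, translation_pow, translation_pow] at h1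
  have h2 : translation (k * a) = (translation (n * a) * lowerTranslation (n * b)) ^ s *
      translation (j * a) * (translation (n * a) * lowerTranslation (n * b)) ^ t := by
    have h3 := congrArg (fun x ↦ N⁻¹ * x * N) h1
    simpa only [mul_assoc, inv_mul_cancel_left, inv_mul_cancel, mul_one] using h3
  have h3 := sq_eq_sq_of_translation_eq (mul_ne_zero hn' hb) h2
  have h4 : (j : ℝ) ^ 2 = (k : ℝ) ^ 2 := by
    have h5 : a ^ 2 * ((j : ℝ) ^ 2 - (k : ℝ) ^ 2) = 0 := by linear_combination h3
    have := (mul_eq_zero.mp h5).resolve_left (by positivity)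
    linarith
  have h6 := (sq_eq_sq₀ (Nat.cast_nonneg j) (Nat.cast_nonneg k)).mp h4
  exact_mod_cast h6

/-- In the chart `N` both lines are semicircles of squared radius `n² a² / 4 + a / b`, with centres
`n a / 2` and `n a / 2 + j a`. They can only meet above the midpoint of the centres, at squared
height `(n² - j²) a² / 4 + a / b`. -/
lemma exists_axis_inter_eq_singleton (ha : a ≠ 0) (hb : b ≠ 0)
    (hα : (α : PSL2R) = N * translation a * N⁻¹)
    (hβ : (β : PSL2R) = N * lowerTranslation b * N⁻¹) {n j : ℕ} (hj0 : j ≠ 0) (hjn : j < n) :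
    ∃ z : ℍ, axis ((α ^ n * β ^ n : S.group) : PSL2R) ∩
      (fun w ↦ ((α ^ j : S.group) : PSL2R) • w) ''
        axis ((α ^ n * β ^ n : S.group) : PSL2R) = {z} := by
  have hn : 2 ≤ n := by omega
  obtain ⟨x₁, x₂, hx, -, -⟩ := exists_fixedPoints ha hb hα hβ
  obtain ⟨h1, h2, h3, hfix⟩ := hx n hn
  have hx12 : x₁ n ≠ x₂ n := by intro h; rw [h] at h3; exact lt_irrefl _ h3
  have haxis : ∀ w : ℍ, w ∈ axis ((α ^ n * β ^ n : S.group) : PSL2R) ↔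
      (N⁻¹ • w).re ^ 2 + (N⁻¹ • w).im ^ 2 - n * a * (N⁻¹ • w).re - a / b = 0 := by
    intro w
    have h4 : x₁ n * x₂ n = -(a / b) := by field_simp; linarith
    rw [axis, hfix, ← image_pair (fun p ↦ N • p), ← smul_mem_geodesicLine_iff N⁻¹, image_image]
    simp only [inv_smul_smul, image_id']
    rw [mem_geodesicLine_coe hx12, h1, h4, ← sub_eq_add_neg]
  have hj : ((α ^ j : S.group) : PSL2R) = N * translation (j * a) * N⁻¹ := by
    rw [Subgroup.coe_pow, hα, conj_pow, translation_pow]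
  have hmem : ∀ w : ℍ, w ∈ (fun w ↦ ((α ^ j : S.group) : PSL2R) • w) ''
      axis ((α ^ n * β ^ n : S.group) : PSL2R) ↔
      ((N⁻¹ • w).re - j * a) ^ 2 + (N⁻¹ • w).im ^ 2 -
        n * a * ((N⁻¹ • w).re - j * a) - a / b = 0 := by
    intro w
    have h5 : N⁻¹ • ((α ^ j : S.group) : PSL2R)⁻¹ • w = translation (-(j * a)) • N⁻¹ • w := by
      rw [hj, ← translation_inv, conj_inv, mul_smul, mul_smul, inv_smul_smul]
    rw [image_smul, Set.mem_smul_set_iff_inv_smul_mem, haxis, h5, translation_smul_re,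
      translation_smul_im, ← sub_eq_add_neg]
  have hja : (j : ℝ) * a ≠ 0 := mul_ne_zero (by exact_mod_cast hj0) ha
  have hr : 0 < ((n : ℝ) ^ 2 - (j : ℝ) ^ 2) * a ^ 2 / 4 + a / b := by
    have e1 : (j : ℝ) + 1 ≤ n := by exact_mod_cast hjn
    have e2 : (1 : ℝ) ≤ j := by exact_mod_cast Nat.one_le_iff_ne_zero.mpr hj0
    -- The first term of the squared height is thus at least `3 a² / 4`, while `mul_pos_or_le` gives
    -- `a / b ≥ -a² / 4`.
    have e3 : (3 : ℝ) ≤ (n : ℝ) ^ 2 - (j : ℝ) ^ 2 := by nlinarith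
    have e4 : 0 < a ^ 2 := by positivity
    have e5 : a / b = a ^ 2 / (a * b) := by field_simp
    have e6 : -(a ^ 2 / 4) ≤ a / b := by
      rw [e5]
      rcases mul_pos_or_le ha hb hα hβ with h | h
      · have : 0 ≤ a ^ 2 / (a * b) := by positivity
        linarith
      · rw [← neg_neg (a * b), div_neg]
        exact neg_le_neg (div_le_div_of_nonneg_left e4.le (by norm_num) (by linarith))
    nlinarith
  set r := √(((n : ℝ) ^ 2 - (j : ℝ) ^ 2) * a ^ 2 / 4 + a / b) with hrdef
  have hr2 : r ^ 2 = ((n : ℝ) ^ 2 - (j : ℝ) ^ 2) * a ^ 2 / 4 + a / b := Real.sq_sqrt hr.le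
  have hr0 : 0 < r := Real.sqrt_pos.mpr hr
  set z₀ : ℍ := ⟨⟨(j + n) * a / 2, r⟩, hr0⟩ with hz₀
  have hre : z₀.re = (j + n) * a / 2 := rfl
  have him : z₀.im = r := rfl
  refine ⟨N • z₀, ?_⟩
  ext w
  rw [mem_inter_iff, haxis, hmem, mem_singleton_iff, ← inv_smul_eq_iff]
  constructor
  · rintro ⟨e1, e2⟩
    have e3 : (N⁻¹ • w).re = (j + n) * a / 2 := by
      have : j * a * ((N⁻¹ • w).re - (j + n) * a / 2) = 0 := by linear_combination (e1 - e2) / 2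
      linarith [(mul_eq_zero.mp this).resolve_left hja]
    have e4 : (N⁻¹ • w).im ^ 2 = r ^ 2 := by
      rw [hr2]
      rw [e3] at e1
      linear_combination e1
    have e5 : (N⁻¹ • w).im = r := (sq_eq_sq₀ (N⁻¹ • w).im_pos.le hr0.le).mp e4
    ext1
    exact Complex.ext e3 e5
  · intro hw
    rw [hw, hre, him, hr2]
    constructor <;> ring

lemma le_intersectionNumber (ha : a ≠ 0) (hb : b ≠ 0)
    (hα : (α : PSL2R) = N * translation a * N⁻¹)
    (hβ : (β : PSL2R) = N * lowerTranslation b * N⁻¹) {n : ℕ} (hn : 2 ≤ n) :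
    n - 1 ≤ S.intersectionNumber (α ^ n * β ^ n) (α ^ n * β ^ n) := by
  obtain ⟨x₁, x₂, hx, -, -⟩ := exists_fixedPoints ha hb hα hβ
  have hcard := ncard_fixedPointSet (hx n hn).2.2.1 (hx n hn).2.2.2
  have h1 : n - 1 = ((fun j : ℕ ↦ DoubleCoset.mk (Subgroup.zpowers (α ^ n * β ^ n))
      (Subgroup.zpowers (α ^ n * β ^ n)) (α ^ j)) '' (Finset.Icc 1 (n - 1) : Finset ℕ)).ncard := by
    rw [Set.ncard_image_of_injective _ (doubleCoset_injOn ha hb hα hβ (by omega)),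
      Set.ncard_coe_finset, Nat.card_Icc, Nat.add_sub_cancel]
  rw [h1]
  refine Set.ncard_le_ncard ?_ (finite_intersections hcard hcard)
  rintro _ ⟨j, hj, rfl⟩
  rw [Finset.mem_coe, Finset.mem_Icc] at hj
  exact ⟨α ^ j, exists_axis_inter_eq_singleton ha hb hα hβ (by omega) (by omega), rfl⟩

end

/-- The intersection number of closed geodesics has no continuous extension to the space of
geodesic currents of a cusped surface. -/
theorem not_exists_continuous_intersection (S : CuspedSurface) :
    ¬ ∃ i : S.Current → S.Current → ℝ, Continuous (Function.uncurry i) ∧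
      ∀ g h : S.group, IsHyperbolic g → IsHyperbolic h → ∀ μ ν : S.Current,
        μ.1 = S.elementMeasure g → ν.1 = S.elementMeasure h →
          i μ ν = S.intersectionNumber g h := by
  rintro ⟨i, hi, hint⟩
  obtain ⟨N, a, b, α, β, ha, hb, hα, hβ⟩ := S.exists_two_cusps
  obtain ⟨η, P, μ, hη, -, -, hlim⟩ := exists_tendsto_current ha hb hα hβ
  have h1 : Tendsto (fun n ↦ i (η n) (η n)) atTop (𝓝 (i μ μ)) :=
    (hi.tendsto (μ, μ)).comp (hlim.prodMk_nhds hlim)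
  have h2 : Tendsto (fun n : ℕ ↦ ((n - 1 : ℕ) : ℝ)) atTop atTop :=
    tendsto_natCast_atTop_atTop.comp (tendsto_sub_atTop_nat 1)
  -- On the diagonal the values of `i` converge by continuity, yet they are at least `n - 1`.
  refine not_tendsto_nhds_of_tendsto_atTop (tendsto_atTop_mono' _ ?_ h2) _ h1
  filter_upwards [eventually_ge_atTop 2] with n hn
  have hyp := isHyperbolic_pow_mul_pow ha hb hα hβ hn
  rw [hint _ _ hyp hyp _ _ (hη n) (hη n)]
  exact_mod_cast le_intersectionNumber ha hb hα hβ hn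

end CuspedSurface

theorem mainTheorem7 (S : CuspedSurface) :
    (∀ α β : S.group, CuspedSurface.IsParabolic α → CuspedSurface.IsParabolic β →
      ∀ p q : OnePoint ℝ, (α : CuspedSurface.PSL2R) • p = p → (β : CuspedSurface.PSL2R) • q = q →
        p ≠ q →
        (∀ n : ℕ, 2 ≤ n → CuspedSurface.IsHyperbolic ((α ^ n * β ^ n : S.group))) ∧
        ∃ (η : ℕ → S.Current) (P : S.Pairs) (μ : S.Current),
          (∀ n, (η n).1 = S.elementMeasure (α ^ n * β ^ n)) ∧
          P.1 = {p, q} ∧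
          μ.1 = 2 • S.pairMeasure P ∧
          Tendsto η atTop (𝓝 μ)) ∧
    ¬ ∃ i : S.Current → S.Current → ℝ,
        Continuous (Function.uncurry i) ∧
        ∀ g h : S.group, CuspedSurface.IsHyperbolic g → CuspedSurface.IsHyperbolic h →
          ∀ μ ν : S.Current, μ.1 = S.elementMeasure g → ν.1 = S.elementMeasure h →
            i μ ν = S.intersectionNumber g h := by
  refine ⟨fun α β hα hβ p q hp hq hpq ↦ ?_, S.not_exists_continuous_intersection⟩
  obtain ⟨N, rfl, rfl⟩ := CuspedSurface.exists_smul_infty_smul_zero hpq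
  obtain ⟨a, ha, hαa⟩ := CuspedSurface.exists_eq_conj_translation hα hp
  obtain ⟨b, hb, hβb⟩ := CuspedSurface.exists_eq_conj_lowerTranslation hβ hq
  exact ⟨fun n hn ↦ CuspedSurface.isHyperbolic_pow_mul_pow ha hb hαa hβb hn,
    CuspedSurface.exists_tendsto_current ha hb hαa hβb⟩
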